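/- Let $S$ be a measure space and let $a,b:S\to[-\infty,\infty]$ be measurable functions with $\inf_{x\in S}(b(x)-a(x))>0$. Let $\mathcal B=\mathcal B(S,\mathbb R)$ be the Banach space of bounded measurable functions $f:S\to\mathbb R$ with norm $\|f\|_\infty=\sup_{x\in S}|f(x)|$, let $M=\{f\in\mathcal B: a(x)\le f(x)\le b(x)\ \forall x\in S\}$ with the metric $d(f,g)=\|f-g\|_\infty$, and let $V:M\to\mathcal B$ be locally Lipschitz. For $f\in M$ and $t\ge 0$ put $X_t(f)(x)=[f(x)+tV(f)(x)]_{a(x)}^{b(x)}$, where $[y]_\alpha^\beta=\min\{\max\{\alpha,y\},\beta\}$. Then: (1) $X$ is an arc field on $M$, i.e. $(f,t)\mapsto X_t(f)$ is a continuous map $M\times[0,1]\to M$ with $X_0=\mathrm{id}$, and it satisfies the following two conditions. (E1) For each $f_0\in M$ there are $r,\delta>0$ and $\Lambda\in\mathbb R$ with $d(X_t(f),X_t(g))\le(1+t\Lambda)\,d(f,g)$ for all $f,g\in B(f_0,r)$ and $0\le t<\delta$, $t\le 1$. (E2) For each $f_0\in M$ there are $r,\delta>0$ and $\Omega\in\mathbb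 R$ with $d(X_{s+t}(f),X_t(X_s(f)))\le st\,\Omega$ for all $f\in B(f_0,r)$ and $0\le t\le s<\delta$, $s+t\le1$. (2) $X$ has a unique (maximal) local forward flow. Here a local forward flow of $X$ is a function $T:M\to(0,\infty]$ such that $D_T=\{(f,t): 0\le t<T(f)\}$ is open in $M\times[0,\infty)$, together with a continuous map $F:D_T\to M$, $(f,t)\mapsto F_t(f)$, such that $F_0(f)=f$ and $F_t(F_s(f))=F_{s+t}(f)$ whenever both sides are defined, and which is forward tangent to $X$: $$\lim_{h\to0^+}\frac{d\big(F_{t+h}(f),X_h(F_t(f))\big)}{h}=0\qquad\text{for all }(f,t)\in D_T .$$ Precisely, there is a local forward flow $(T,F)$ of $X$ such that every local forward flow $(T',F')$ of $X$ is a restriction of it: $T'\le T$, and $F'_t(f)=F_t(f)$ for all $0\le t<T'(f)$. (3) $F$ is the limit of Euler curves: $F_t(f)=\lim_{n\to\infty}X_{t/n}^{(n)}(f)$ for all $f\in M$ and $0\le t<T(f)$, where $X_{t}^{(n)}$ is the $n$-fold composition of $X_{t}$ with itself. (4) If $V$ is globally Lipschitz, then $T(f)=\infty$ for all $f\in M$,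 so that $F:M\times[0,\infty)\to M$ is a forward flow of $X$ (continuous, $F_0=\mathrm{id}$, $F_t\circ F_s=F_{s+t}$ for all $s,t\ge0$, forward tangent to $X$), and it is the only one. -/

import Mathlib

open Filter Topology
open scoped NNReal ENNReal

namespace ArcField

section General

variable {M : Type*} [MetricSpace M]

/-- `X` is an arc field on `M`: a continuous map on `M × [0,1]` with `X₀ = id`.
Times are nonnegative reals; only the values of `X t` for `t ≤ 1` are constrained. -/
def IsArcField (X : ℝ≥0 → M → M) : Prop :=
  ContinuousOn (fun p : M × ℝ≥0 => X p.2 p.1) {p | p.2 ≤ 1} ∧ ∀ f, X 0 f = f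

/-- Condition E1 (local linear spread of the arc field). -/
def CondE1 (X : ℝ≥0 → M → M) : Prop :=
  ∀ f₀ : M, ∃ r > (0 : ℝ), ∃ δ > (0 : ℝ), ∃ Λ : ℝ,
    ∀ f ∈ Metric.ball f₀ r, ∀ g ∈ Metric.ball f₀ r, ∀ t : ℝ≥0, t ≤ 1 → (t : ℝ) < δ →
      dist (X t f) (X t g) ≤ (1 + t * Λ) * dist f g

/-- Condition E2 (the arc field is almost a flow). -/
def CondE2 (X : ℝ≥0 → M → M) : Prop :=
  ∀ f₀ : M, ∃ r > (0 : ℝ), ∃ δ > (0 : ℝ), ∃ Ω : ℝ,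
    ∀ f ∈ Metric.ball f₀ r, ∀ s t : ℝ≥0, t ≤ s → (s : ℝ) < δ → s + t ≤ 1 →
      dist (X (s + t) f) (X t (X s f)) ≤ s * t * Ω

/-- The curve `σ` is forward tangent to `X` at time `t`:
`d(σ(t + h), X_h(σ(t))) / h → 0` as `h → 0⁺`. -/
def ForwardTangentAt (X : ℝ≥0 → M → M) (σ : ℝ≥0 → M) (t : ℝ≥0) : Prop :=
  Tendsto (fun h : ℝ≥0 => dist (σ (t + h)) (X h (σ t)) / (h : ℝ)) (𝓝[>] 0) (𝓝 0)

/-- `F : M × [0,∞) → M` is a forward flow of the arc field `X`. -/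
structure IsFlowOf (X : ℝ≥0 → M → M) (F : ℝ≥0 → M → M) : Prop where
  continuous : Continuous (fun p : M × ℝ≥0 => F p.2 p.1)
  zero : ∀ f, F 0 f = f
  add : ∀ f s t, F t (F s f) = F (s + t) f
  tangent : ∀ f t, ForwardTangentAt X (fun u => F u f) t

/-- `F`, with lifetime function `T : M → (0,∞]`, is a local forward flow of the arc field `X`:
it is defined and continuous on the set `{(f,t) | 0 ≤ t < T f}`, which is open in `M × [0,∞)`,
it satisfies the flow identities wherever both sides are defined, and it is forward tangent to
`X`. The values of `F t f` for `t ≥ T f` are irrelevant. -/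
structure IsLocalFlowOf (X : ℝ≥0 → M → M) (T : M → ℝ≥0∞) (F : ℝ≥0 → M → M) : Prop where
  pos : ∀ f, 0 < T f
  isOpen_domain : IsOpen {p : M × ℝ≥0 | (p.2 : ℝ≥0∞) < T p.1}
  continuousOn : ContinuousOn (fun p : M × ℝ≥0 => F p.2 p.1) {p | (p.2 : ℝ≥0∞) < T p.1}
  zero : ∀ f, F 0 f = f
  add : ∀ (f : M) (s t : ℝ≥0), (s : ℝ≥0∞) < T f → (t : ℝ≥0∞) < T (F s f) →
    ((s + t : ℝ≥0) : ℝ≥0∞) < T f → F t (F s f) = F (s + t) f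
  tangent : ∀ (f : M) (t : ℝ≥0), (t : ℝ≥0∞) < T f → ForwardTangentAt X (fun u => F u f) t

end General

section Clip

/-- The clip `[x]_lo^hi = min (max lo x) hi` of a real number at extended real bounds.
It is a real number as soon as `lo < ∞` and `-∞ < hi`. -/
noncomputable def clip (lo hi : EReal) (x : ℝ) : ℝ := (min (max lo (x : EReal)) hi).toReal

theorem lt_of_sub_pos {lo hi : EReal} (h : 0 < hi - lo) : lo < hi := by
  by_contra hc
  have := EReal.sub_nonpos.2 (not_lt.1 hc)
  exact absurd h (not_lt.2 this)

theorem coe_clip {lo hi : EReal} (h : lo < hi) (x : ℝ) :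
    ((clip lo hi x : ℝ) : EReal) = min (max lo (x : EReal)) hi := by
  apply EReal.coe_toReal
  · exact (lt_of_le_of_lt (min_le_left _ _)
      (max_lt (lt_of_lt_of_le h le_top) (EReal.coe_lt_top x))).ne
  · exact (lt_min (lt_of_lt_of_le (EReal.bot_lt_coe x) (le_max_right _ _))
      (lt_of_le_of_lt bot_le h)).ne'

/-- A bound for the clip when the interval `[lo, hi]` contains the real number `y`. -/
theorem abs_clip_le {lo hi : EReal} (h : lo < hi) (x y : ℝ) (h₁ : lo ≤ y) (h₂ : (y : EReal) ≤ hi) :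
    |clip lo hi x| ≤ max |x| |y| := by
  have hc := coe_clip h x
  rcases le_total (max lo (x : EReal)) hi with h3 | h3
  · rw [min_eq_left h3] at hc
    rcases le_total lo (x : EReal) with h4 | h4
    · rw [max_eq_right h4] at hc
      rw [EReal.coe_eq_coe_iff.1 hc]
      exact le_max_left _ _
    · rw [max_eq_left h4] at hc
      rw [← hc] at h4 h₁
      exact abs_le_max_abs_abs (EReal.coe_le_coe_iff.1 h4) (EReal.coe_le_coe_iff.1 h₁)
  · rw [min_eq_right h3] at hc
    have h5 : (x : EReal) ≥ hi := by
      by_contra h6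
      exact absurd h3 (not_le.2 (max_lt h (not_le.1 h6)))
    rw [← hc] at h5 h₂
    rw [max_comm]
    exact abs_le_max_abs_abs (EReal.coe_le_coe_iff.1 h₂) (EReal.coe_le_coe_iff.1 h5)

variable (S : Type*) [MeasurableSpace S]

/-- The Banach space `ℬ(S,ℝ)` of bounded measurable functions `S → ℝ`, as a subspace of
the space `ℓ^∞` of all bounded functions with the norm `‖f‖ = sup |f|`. -/
def BddMeas : Submodule ℝ (lp (fun _ : S => ℝ) ∞) where
  carrier := {f | Measurable fun x => f x}
  add_mem' hf hg := Measurable.add hf hg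
  zero_mem' := measurable_const (a := (0 : ℝ))
  smul_mem' c _ hf := Measurable.const_smul hf c

variable {S}

/-- The metric space `M` (with the sup metric) of bounded measurable functions between the
barriers `a` and `b`. -/
def Between (a b : S → EReal) : Set (BddMeas S) :=
  {f | ∀ x, a x ≤ ((f.1 x : ℝ) : EReal) ∧ ((f.1 x : ℝ) : EReal) ≤ b x}

/-- The clipped arc field `X_t(f)(x) = [f(x) + t V(f)(x)]_{a(x)}^{b(x)}` on `M`. -/
noncomputable def clipArc (a b : S → EReal) (ha : Measurable a) (hb : Measurable b)
    (hab : 0 < ⨅ x, (b x - a x)) (V : Between a b → BddMeas S)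
    (t : ℝ≥0) (f : Between a b) : Between a b :=
  have hlt : ∀ x, a x < b x := fun x => lt_of_sub_pos (lt_of_lt_of_le hab (iInf_le _ x))
  ⟨⟨⟨fun x => clip (a x) (b x) (f.1.1 x + t * (V f).1 x), by
        refine memℓp_infty ⟨max (‖f.1.1‖ + t * ‖(V f).1‖) ‖f.1.1‖, ?_⟩
        rintro _ ⟨x, rfl⟩
        have h1 : |f.1.1 x| ≤ ‖f.1.1‖ := lp.norm_apply_le_norm ENNReal.top_ne_zero f.1.1 x
        have h2 : |(V f).1 x| ≤ ‖(V f).1‖ := lp.norm_apply_le_norm ENNReal.top_ne_zero (V f).1 x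
        refine (abs_clip_le (hlt x) _ _ (f.2 x).1 (f.2 x).2).trans (max_le_max ?_ h1)
        refine (abs_add_le _ _).trans (add_le_add h1 ?_)
        rw [abs_mul, NNReal.abs_eq]
        exact mul_le_mul_of_nonneg_left h2 t.coe_nonneg⟩, by
      have h1 : Measurable fun x => f.1.1 x := f.1.2
      have h2 : Measurable fun x => (V f).1 x := (V f).2
      exact ((ha.max (h1.add (h2.const_mul (t : ℝ))).coe_real_ereal).min hb).ereal_toReal⟩, by
    intro x
    change a x ≤ ((clip (a x) (b x) _ : ℝ) : EReal) ∧ ((clip (a x) (b x) _ : ℝ) : EReal) ≤ b x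
    rw [coe_clip (hlt x)]
    exact ⟨le_min (le_max_left _ _) (hlt x).le, min_le_right _ _⟩⟩

end Clip

end ArcField

open ArcField

/-!
E2 says that an arc agrees, up to an error quadratic in time, with the Euler polygons that replace
it, and E1 says that the arcs are stable; a discrete Grönwall argument makes the Euler polygons
converge locally to integral curves. Two integral curves are compared by a Grönwall inequality for
their distance truncated at the radius of a tube around one of them, so that E1 is only needed in
the tube, which a compact orbit has. This gives uniqueness, the openness of the domain of the
maximal flow and its continuity there, and, with the same stability along a compact orbit, the
convergence of the Euler curves at all times below the lifetime.

For the clipped field, clipping is nonexpansive, which gives E1. Clipping twice along a fixed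
direction is the same as clipping once, so that E2 only sees the variation of `V` along an arc. If
`V` grows at most linearly, an integral curve is Lipschitz on bounded time intervals, hence by
completeness it does not end in finite time.
-/

namespace ArcField

section Auxiliary

theorem exists_ge_forall_mul_le_one {P : ℝ≥0 → Prop} (hP : ∀ᶠ s in 𝓝 0, P s) (L₀ : ℝ≥0) :
    ∃ L ≥ L₀, ∀ s, L * s ≤ 1 → P s := by
  obtain ⟨ε, hε, hεP⟩ := Metric.eventually_nhds_iff.1 hP
  lift ε to ℝ≥0 using hε.le
  have hε' : 0 < ε := by exact_mod_cast hε
  refine ⟨max L₀ (2 / ε), le_max_left _ _, fun s hs => hεP ?_⟩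
  have h2 : 2 / ε * s ≤ 1 := (mul_le_mul_left (le_max_right _ _) s).trans hs
  rw [NNReal.dist_eq, NNReal.coe_zero, sub_zero, NNReal.abs_eq, NNReal.coe_lt_coe]
  rw [div_mul_eq_mul_div, div_le_one hε'] at h2
  rcases eq_zero_or_pos s with rfl | hs0
  · exact hε'
  · exact (by rw [two_mul]; exact lt_add_of_pos_left s hs0 : s < 2 * s).trans_le h2

theorem exists_forall_ball_of_isCompact {M : Type*} [PseudoMetricSpace M]
    {P : ℝ≥0 → Set M → Prop}
    (hmono : ∀ {L L' U U'}, L ≤ L' → U' ⊆ U → P L U → P L' U')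
    (hloc : ∀ p, ∃ L, ∃ U ∈ 𝓝 p, P L U) {K : Set M} (hK : IsCompact K) :
    ∃ L, ∃ r > 0, ∀ p ∈ K, P L (Metric.ball p r) := by
  refine hK.induction_on (p := fun K => ∃ L, ∃ r > 0, ∀ p ∈ K, P L (Metric.ball p r))
    ⟨0, 1, one_pos, by simp⟩ ?_ ?_ ?_
  · rintro s t hst ⟨L, r, hr, h⟩
    exact ⟨L, r, hr, fun p hp => h p (hst hp)⟩
  · rintro s t ⟨L, r, hr, h⟩ ⟨L', r', hr', h'⟩
    refine ⟨max L L', min r r', lt_min hr hr', ?_⟩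
    rintro p (hp | hp)
    · exact hmono (le_max_left _ _) (Metric.ball_subset_ball (min_le_left _ _)) (h p hp)
    · exact hmono (le_max_right _ _) (Metric.ball_subset_ball (min_le_right _ _)) (h' p hp)
  · intro p _
    obtain ⟨L, U, hU, h⟩ := hloc p
    obtain ⟨r, hr, hrU⟩ := Metric.mem_nhds_iff.1 hU
    refine ⟨Metric.ball p (r / 2), mem_nhdsWithin_of_mem_nhds
      (Metric.ball_mem_nhds _ (half_pos hr)), L, r / 2, half_pos hr, fun q hq => ?_⟩
    exact hmono le_rfl ((Metric.ball_subset_ball' (by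
      rw [Metric.mem_ball] at hq; linarith)).trans hrU) h

theorem exp_le_three_of_le_one {x : ℝ} (hx : x ≤ 1) : Real.exp x ≤ 3 :=
  (Real.exp_le_exp.2 hx).trans Real.exp_one_lt_three.le

/-- A discrete Grönwall inequality whose recursion only has to hold as long as the bound that it
yields does. -/
theorem le_mul_exp_of_step_le {e : ℕ → ℝ} {a b : ℝ} {n : ℕ} (ha : 0 ≤ a) (hb : 0 ≤ b)
    (h0 : e 0 ≤ 0)
    (hstep : ∀ k < n, e k ≤ n * b * Real.exp (n * a) → e (k + 1) ≤ (1 + a) * e k + b) :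
    ∀ k ≤ n, e k ≤ k * b * Real.exp (k * a) := by
  intro k hk
  induction k with
  | zero => simpa using h0
  | succ k ih =>
    have hkn : (k : ℝ) ≤ n := by exact_mod_cast (Nat.le_succ k).trans hk
    have hek : e k ≤ k * b * Real.exp (k * a) := ih ((Nat.le_succ k).trans hk)
    have h1 : (1 + a) * (k * b * Real.exp (k * a)) ≤ k * b * Real.exp ((k + 1 : ℕ) * a) := by
      have : Real.exp ((k + 1 : ℕ) * a) = Real.exp a * Real.exp (k * a) := by
        rw [← Real.exp_add]; push_cast; ring_nf
      rw [this, mul_left_comm]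
      gcongr
      linarith [Real.add_one_le_exp a]
    have h2 : b ≤ b * Real.exp ((k + 1 : ℕ) * a) :=
      le_mul_of_one_le_right hb (Real.one_le_exp (by positivity))
    calc e (k + 1) ≤ (1 + a) * e k + b := hstep k hk (hek.trans (by gcongr))
      _ ≤ (1 + a) * (k * b * Real.exp (k * a)) + b := by gcongr
      _ ≤ k * b * Real.exp ((k + 1 : ℕ) * a) + b * Real.exp ((k + 1 : ℕ) * a) := add_le_add h1 h2
      _ = (k + 1 : ℕ) * b * Real.exp ((k + 1 : ℕ) * a) := by push_cast; ring

theorem tendsto_toNNReal_sub (w : ℝ≥0) :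
    Tendsto (fun z : ℝ => (z - w).toNNReal) (𝓝[>] (w : ℝ)) (𝓝[>] 0) := by
  refine tendsto_nhdsWithin_iff.2 ⟨?_, ?_⟩
  · have : Continuous fun z : ℝ => (z - w).toNNReal := by fun_prop
    simpa using (this.tendsto w).mono_left nhdsWithin_le_nhds
  · filter_upwards [self_mem_nhdsWithin] with z hz
    simpa using hz

theorem le_gronwallBound_of_forall_eventually_lt {φ : ℝ≥0 → ℝ} {K ε : ℝ} {b : ℝ≥0}
    (hφ : ContinuousOn φ (Set.Icc 0 b))
    (hslope : ∀ u < b, ∀ r > K * φ u + ε, ∀ᶠ h : ℝ≥0 in 𝓝[>] 0, φ (u + h) < φ u + r * h) :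
    ∀ u ≤ b, φ u ≤ gronwallBound (φ 0) K ε u := by
  have hmaps : Set.MapsTo Real.toNNReal (Set.Icc ((0 : ℝ≥0) : ℝ) b) (Set.Icc 0 b) := fun y hy =>
    ⟨zero_le, Real.toNNReal_le_iff_le_coe.2 hy.2⟩
  intro u hu
  have key := le_gronwallBound_of_liminf_deriv_right_le (f := fun y : ℝ => φ y.toNNReal)
    (f' := fun y => K * φ y.toNNReal + ε) (δ := φ 0) (K := K) (ε := ε) (a := (0 : ℝ≥0)) (b := b)
    (hφ.comp continuous_real_toNNReal.continuousOn hmaps) ?_ (by simp) (fun _ _ => le_rfl)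
    u ⟨by simp, by exact_mod_cast hu⟩
  · simpa using key
  · intro y hy r hr
    lift y to ℝ≥0 using hy.1
    have hyb : y < b := by exact_mod_cast hy.2
    simp only [Real.toNNReal_coe] at hr
    refine Eventually.frequently ?_
    filter_upwards [(tendsto_toNNReal_sub y).eventually (hslope y hyb r hr),
      self_mem_nhdsWithin] with z hz hyz
    have hpos : 0 < z - y := sub_pos.2 hyz
    have hadd : y + (z - y).toNNReal = z.toNNReal := by
      rw [← NNReal.coe_inj, NNReal.coe_add, Real.coe_toNNReal _ hpos.le,
        Real.coe_toNNReal _ (y.coe_nonneg.trans (Set.mem_Ioi.1 hyz).le)]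
      ring
    rw [hadd, Real.coe_toNNReal _ hpos.le] at hz
    rw [inv_mul_lt_iff₀ hpos, Real.toNNReal_coe]
    linarith

end Auxiliary

section Euler

variable {M : Type*} {X : ℝ≥0 → M → M} {L L' : ℝ≥0} {U U' : Set M}

/-- The Euler polygons from `f` stay in `U` up to the time `1 / L`. -/
def TrappedIn (X : ℝ≥0 → M → M) (L : ℝ≥0) (U : Set M) (f : M) : Prop :=
  ∀ (n : ℕ) (h : ℝ≥0), L * (n * h) ≤ 1 → (X h)^[n] f ∈ U

theorem TrappedIn.mono {f : M} (hL : L ≤ L') (h : TrappedIn X L U f) : TrappedIn X L' U f :=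
  fun n t ht => h n t ((mul_le_mul_left hL _).trans ht)

variable [MetricSpace M]

/-- Condition E1 on a set, with the rate `L` on the times `t ≤ 1 / L`. Letting one constant play
both roles makes the condition monotone in `L`. -/
def SpreadOn (X : ℝ≥0 → M → M) (L : ℝ≥0) (U : Set M) : Prop :=
  ∀ f ∈ U, ∀ g ∈ U, ∀ t, L * t ≤ 1 → dist (X t f) (X t g) ≤ (1 + L * t) * dist f g

/-- Condition E2 on a set, with the rate `L` on the times `s + t ≤ 1 / L`. -/
def DefectOn (X : ℝ≥0 → M → M) (L : ℝ≥0) (U : Set M) : Prop :=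
  ∀ f ∈ U, ∀ s t, t ≤ s → L * (s + t) ≤ 1 → dist (X (s + t) f) (X t (X s f)) ≤ L * (s * t)

/-- The defect of an arc with respect to all its Euler polygons is quadratic in time. -/
def EulerDefectOn (X : ℝ≥0 → M → M) (L : ℝ≥0) (U : Set M) : Prop :=
  ∀ f ∈ U, ∀ (n : ℕ) (h : ℝ≥0), L * (n * h) ≤ 1 →
    dist (X (n * h) f) ((X h)^[n] f) ≤ L * (n * h) ^ 2

theorem SpreadOn.mono (hL : L ≤ L') (hU : U' ⊆ U) (h : SpreadOn X L U) : SpreadOn X L' U' :=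
  fun f hf g hg t ht => (h f (hU hf) g (hU hg) t ((mul_le_mul_left hL t).trans ht)).trans
    (by gcongr)

theorem DefectOn.mono (hL : L ≤ L') (hU : U' ⊆ U) (h : DefectOn X L U) : DefectOn X L' U' :=
  fun f hf s t hts ht => (h f (hU hf) s t hts ((mul_le_mul_left hL _).trans ht)).trans
    (by gcongr)

theorem EulerDefectOn.mono (hL : L ≤ L') (hU : U' ⊆ U) (h : EulerDefectOn X L U) :
    EulerDefectOn X L' U' :=
  fun f hf n t ht => (h f (hU hf) n t ((mul_le_mul_left hL _).trans ht)).trans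
    (by gcongr)

theorem eventually_le_one_and_coe_lt {δ : ℝ} (hδ : 0 < δ) :
    ∀ᶠ s : ℝ≥0 in 𝓝 0, s ≤ 1 ∧ (s : ℝ) < δ :=
  (ge_mem_nhds one_pos).and (NNReal.continuous_coe.continuousAt.eventually (gt_mem_nhds hδ))

theorem CondE1.exists_spreadOn (hX : CondE1 X) (p : M) : ∃ L, ∃ U ∈ 𝓝 p, SpreadOn X L U := by
  obtain ⟨r, hr, δ, hδ, Λ, h⟩ := hX p
  obtain ⟨L, hL, hLδ⟩ :=
    exists_ge_forall_mul_le_one (eventually_le_one_and_coe_lt hδ) Λ.toNNReal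
  refine ⟨L, _, Metric.ball_mem_nhds p hr, fun f hf g hg t ht => ?_⟩
  refine (h f hf g hg t (hLδ t ht).1 (hLδ t ht).2).trans ?_
  rw [mul_comm (L : ℝ)]
  gcongr
  exact Real.toNNReal_le_iff_le_coe.1 hL

theorem CondE2.exists_defectOn (hX : CondE2 X) (p : M) : ∃ L, ∃ U ∈ 𝓝 p, DefectOn X L U := by
  obtain ⟨r, hr, δ, hδ, Ω, h⟩ := hX p
  obtain ⟨L, hL, hLδ⟩ :=
    exists_ge_forall_mul_le_one (eventually_le_one_and_coe_lt hδ) Ω.toNNReal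
  refine ⟨L, _, Metric.ball_mem_nhds p hr, fun f hf s t hts hst => ?_⟩
  have hs : L * s ≤ 1 := (mul_le_mul_right (le_add_of_nonneg_right zero_le) L).trans hst
  refine (h f hf s t hts (hLδ s hs).2 (hLδ _ hst).1).trans ?_
  rw [mul_comm (L : ℝ)]
  gcongr
  exact Real.toNNReal_le_iff_le_coe.1 hL

theorem CondE1.exists_spreadOn_ball (hX : CondE1 X) {K : Set M} (hK : IsCompact K) :
    ∃ L, ∃ r > 0, ∀ p ∈ K, SpreadOn X L (Metric.ball p r) :=
  exists_forall_ball_of_isCompact SpreadOn.mono hX.exists_spreadOn hK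

theorem IsArcField.continuous_arc (hX : IsArcField X) {t : ℝ≥0} (ht : t ≤ 1) :
    Continuous (X t) :=
  continuousOn_univ.1 (hX.1.comp (f := fun f : M => (f, t)) (by fun_prop) fun _ _ => ht)

theorem IsArcField.exists_arc_mem (hX : IsArcField X) {p : M} (hU : U ∈ 𝓝 p) :
    ∃ L, ∃ W ∈ 𝓝 p, ∀ f ∈ W, ∀ s, L * s ≤ 1 → X s f ∈ U := by
  have hlim : Tendsto (fun q : M × ℝ≥0 => X q.2 q.1) (𝓝 p ×ˢ 𝓝 0) (𝓝 p) := by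
    rw [← nhds_prod_eq]
    simpa only [ContinuousAt, hX.2] using
      hX.1.continuousAt (x := (p, 0))
        (continuous_snd.continuousAt.eventually (ge_mem_nhds one_pos))
  obtain ⟨A, hA, B, hB, hAB⟩ := eventually_prod_iff.1 (hlim.eventually_mem hU)
  obtain ⟨L, -, hL⟩ := exists_ge_forall_mul_le_one hB 0
  exact ⟨L, {f | A f}, hA, fun f hf s hs => hAB hf (hL s hs)⟩

theorem DefectOn.dist_arc_add_le (h0 : ∀ f, X 0 f = f) (hD : DefectOn X L U) {f : M} (hf : f ∈ U)
    {k : ℕ} {h : ℝ≥0} (hk : L * (k * h + h) ≤ 1) :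
    dist (X (k * h + h) f) (X h (X (k * h) f)) ≤ L * (k * h * h) := by
  rcases Nat.eq_zero_or_pos k with rfl | hk1
  · simp [h0]
  · simpa using hD f hf (k * h) h (le_mul_of_one_le_left zero_le (by exact_mod_cast hk1)) hk

theorem dist_arc_iterate_le (h0 : ∀ f, X 0 f = f) {p : M} {r : ℝ}
    (hS : SpreadOn X L (Metric.ball p r)) (hD : DefectOn X L U) {f : M} (hf : f ∈ U)
    (hmem : ∀ s, L * s ≤ 1 → X s f ∈ Metric.ball p (r / 2)) {n : ℕ} {h : ℝ≥0}
    (hn : L * (n * h) ≤ 1) (hr : 6 * (n * h : ℝ) < r) :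
    dist (X (n * h) f) ((X h)^[n] f) ≤ 3 * L * (n * h) ^ 2 := by
  have hn' : (L * (n * h) : ℝ) ≤ 1 := by exact_mod_cast hn
  have hnh : (0 : ℝ) ≤ n * h := by positivity
  have hbound : (n * (L * (n * h * h)) * Real.exp (n * (L * h)) : ℝ) ≤ 3 * L * (n * h) ^ 2 := by
    calc (n * (L * (n * h * h)) * Real.exp (n * (L * h)) : ℝ)
        ≤ n * (L * (n * h * h)) * 3 := by gcongr; exact exp_le_three_of_le_one (by linarith [hn'])
      _ = 3 * L * (n * h) ^ 2 := by ring
  have hsmall : (3 * L * (n * h) ^ 2 : ℝ) < r / 2 := by nlinarith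
  refine (le_mul_exp_of_step_le (e := fun k => dist (X (k * h) f) ((X h)^[k] f))
    (a := L * h) (b := L * (n * h * h)) (by positivity) (by positivity) (by simp [h0])
    (fun k hk hek => ?_) n le_rfl).trans hbound
  have hkn : (k + 1 : ℝ≥0) ≤ n := by exact_mod_cast hk
  have hkh : L * (k * h + h) ≤ 1 := by
    refine le_trans ?_ hn
    rw [← add_one_mul]
    gcongr
  have harc : X (k * h) f ∈ Metric.ball p (r / 2) :=
    hmem _ ((mul_le_mul_right (le_add_of_nonneg_right zero_le) L).trans hkh)
  have hiter : (X h)^[k] f ∈ Metric.ball p r := by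
    rw [Metric.mem_ball] at harc ⊢
    linarith [dist_triangle_left ((X h)^[k] f) p (X (k * h) f)]
  have hspread := hS _ (Metric.ball_subset_ball (by linarith) harc) _ hiter h
    ((mul_le_mul_right (le_add_of_nonneg_left zero_le) L).trans hkh)
  have hdefect : dist (X (k * h + h) f) (X h (X (k * h) f)) ≤ L * (n * h * h) :=
    (hD.dist_arc_add_le h0 hf hkh).trans (by gcongr)
  rw [Function.iterate_succ_apply', Nat.cast_succ, add_one_mul]
  linarith [dist_triangle (X (k * h + h) f) (X h (X (k * h) f)) (X h ((X h)^[k] f))]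

theorem exists_eulerDefectOn (hX : IsArcField X) (h1 : CondE1 X) (h2 : CondE2 X) (p : M) :
    ∃ L, ∃ U ∈ 𝓝 p, EulerDefectOn X L U := by
  obtain ⟨L₁, r, hr, hS⟩ := h1.exists_spreadOn_ball (isCompact_singleton (x := p))
  obtain ⟨L₂, U, hU, hD⟩ := h2.exists_defectOn p
  obtain ⟨L₃, W, hW, hWmem⟩ := hX.exists_arc_mem (Metric.ball_mem_nhds p (half_pos hr))
  have hev : ∀ᶠ s : ℝ≥0 in 𝓝 0, 6 * (s : ℝ) < r :=
    Tendsto.eventually_lt_const (v := 0) hr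
      (Continuous.tendsto' (by fun_prop) _ _ (by simp))
  set L := max L₁ (max L₂ L₃)
  have hL₃ : L₃ ≤ L := (le_max_right _ _).trans (le_max_right _ _)
  obtain ⟨L', hL', hL'r⟩ := exists_ge_forall_mul_le_one hev (3 * L)
  have hLL' : L ≤ L' := le_trans (le_mul_of_one_le_left zero_le (by norm_num)) hL'
  refine ⟨L', U ∩ W, inter_mem hU hW, fun f hf n h hn => ?_⟩
  refine (dist_arc_iterate_le hX.2 ((hS p rfl).mono (le_max_left _ _) le_rfl)
    (hD.mono ((le_max_left _ _).trans (le_max_right _ _)) le_rfl) hf.1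
    (fun s hs => hWmem f hf.2 s ((mul_le_mul_left hL₃ s).trans hs))
    ((mul_le_mul_left hLL' _).trans hn) (by exact_mod_cast hL'r _ hn)).trans ?_
  gcongr
  exact_mod_cast hL'

theorem exists_trappedIn (hX : IsArcField X) (h1 : CondE1 X) (h2 : CondE2 X) {p : M}
    (hU : U ∈ 𝓝 p) : ∃ L, ∃ W ∈ 𝓝 p, ∀ f ∈ W, TrappedIn X L U f := by
  obtain ⟨ε, hε, hεU⟩ := Metric.mem_nhds_iff.1 hU
  obtain ⟨L₁, V, hV, hVdef⟩ := exists_eulerDefectOn hX h1 h2 p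
  obtain ⟨L₂, W, hW, hWmem⟩ := hX.exists_arc_mem (Metric.ball_mem_nhds p (half_pos hε))
  have hev : ∀ᶠ s : ℝ≥0 in 𝓝 0, (s : ℝ) < ε / 2 :=
    NNReal.continuous_coe.continuousAt.eventually (gt_mem_nhds (half_pos hε))
  obtain ⟨L, hL, hLε⟩ := exists_ge_forall_mul_le_one hev (max L₁ L₂)
  have hL₁ : L₁ ≤ L := (le_max_left _ _).trans hL
  have hL₂ : L₂ ≤ L := (le_max_right _ _).trans hL
  refine ⟨L, V ∩ W, inter_mem hV hW, fun f hf n h hn => hεU ?_⟩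
  have harc := hWmem f hf.2 (n * h) ((mul_le_mul_left hL₂ _).trans hn)
  have hdef := hVdef.mono hL₁ le_rfl f hf.1 n h hn
  have hn' : (L * (n * h) : ℝ) ≤ 1 := by exact_mod_cast hn
  have hsmall : (n * h : ℝ) < ε / 2 := by exact_mod_cast hLε _ hn
  rw [Metric.mem_ball] at harc ⊢
  nlinarith [dist_triangle_left ((X h)^[n] f) p (X (n * h) f),
    mul_nonneg n.cast_nonneg h.coe_nonneg]

end Euler

section LocalExistence

variable {M : Type*} {X : ℝ≥0 → M → M} {L : ℝ≥0} {U : Set M} {f : M}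

/-- The end point at time `t` of the Euler polygon with `n` steps. -/
noncomputable def eulerCurve (X : ℝ≥0 → M → M) (n : ℕ) (t : ℝ≥0) (f : M) : M := (X (t / n))^[n] f

variable [MetricSpace M]

/-- The Euler polygons from `f` converge, uniformly up to the time `1 / L`, to the curve `σ`. -/
def IsEulerLimit (X : ℝ≥0 → M → M) (L : ℝ≥0) (f : M) (σ : ℝ≥0 → M) : Prop :=
  ∀ (k : ℕ) (h : ℝ≥0), L * (k * h) ≤ 1 → dist ((X h)^[k] f) (σ (k * h)) ≤ 3 * h

/-- `σ` is continuous and forward tangent to `X` at time `t`. -/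
def IsSolutionAt (X : ℝ≥0 → M → M) (σ : ℝ≥0 → M) (t : ℝ≥0) : Prop :=
  ContinuousAt σ t ∧ ForwardTangentAt X σ t

/-- `σ` is an integral curve of `X` on the time interval `[0, c)`. -/
def IsSolution (X : ℝ≥0 → M → M) (σ : ℝ≥0 → M) (c : ℝ≥0∞) : Prop :=
  ∀ t : ℝ≥0, (t : ℝ≥0∞) < c → IsSolutionAt X σ t

theorem dist_iterate_refine_le (hS : SpreadOn X L U) (hE : EulerDefectOn X L U)
    (hf : TrappedIn X L U f) {n m : ℕ} {h : ℝ≥0} (hn : L * (n * (m * h)) ≤ 1) :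
    dist ((X (m * h))^[n] f) ((X h)^[m * n] f) ≤ 3 * (m * h) := by
  have hn' : (L * (n * (m * h)) : ℝ) ≤ 1 := by exact_mod_cast hn
  refine (le_mul_exp_of_step_le (e := fun k => dist ((X (m * h))^[k] f) ((X h)^[m * k] f))
    (a := L * (m * h)) (b := L * (m * h) ^ 2) (by positivity) (by positivity) (by simp)
    (fun k hk _ => ?_) n le_rfl).trans ?_
  · have hkn : L * (k * (m * h)) ≤ 1 := le_trans (by gcongr) hn
    have h1n : L * (m * h) ≤ 1 := by
      refine le_trans (mul_le_mul_right (le_mul_of_one_le_left zero_le ?_) L) hn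
      exact_mod_cast Nat.one_le_of_lt hk
    have hmem : (X h)^[m * k] f ∈ U := hf _ _ (by push_cast; rwa [mul_comm (m : ℝ≥0), mul_assoc])
    have hspread := hS _ (hf k _ hkn) _ hmem _ h1n
    have hdefect := hE _ hmem m h h1n
    rw [Function.iterate_succ_apply', Nat.mul_succ, add_comm, Function.iterate_add_apply]
    push_cast at hspread
    linarith [dist_triangle (X (m * h) ((X (m * h))^[k] f)) (X (m * h) ((X h)^[m * k] f))
      ((X h)^[m] ((X h)^[m * k] f))]
  · calc (n * (L * (m * h) ^ 2) * Real.exp (n * (L * (m * h))) : ℝ)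
        ≤ n * (L * (m * h) ^ 2) * 3 := by gcongr; exact exp_le_three_of_le_one (by linarith)
      _ = L * (n * (m * h)) * (3 * (m * h)) := by ring
      _ ≤ 3 * (m * h) := mul_le_of_le_one_left (by positivity) hn'

theorem dist_eulerCurve_le (hS : SpreadOn X L U) (hE : EulerDefectOn X L U)
    (hf : TrappedIn X L U f) {n m : ℕ} (hn : n ≠ 0) (hm : m ≠ 0) {t : ℝ≥0} (ht : L * t ≤ 1) :
    dist (eulerCurve X n t f) (eulerCurve X m t f) ≤ 3 * (t / n) + 3 * (t / m) := by
  have refine_le : ∀ {n m : ℕ}, n ≠ 0 → m ≠ 0 →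
      dist (eulerCurve X n t f) (eulerCurve X (m * n) t f) ≤ 3 * (t / n) := by
    intro n m hn hm
    have hn' : (n : ℝ≥0) ≠ 0 := by exact_mod_cast hn
    have hm' : (m : ℝ≥0) ≠ 0 := by exact_mod_cast hm
    have hstep : m * (t / (m * n : ℕ)) = t / n := by push_cast; field_simp
    have key := dist_iterate_refine_le hS hE hf (n := n) (m := m) (h := t / (m * n : ℕ))
      (by rwa [hstep, mul_div_cancel₀ _ hn'])
    rw [hstep] at key
    exact key.trans_eq (by rw [← NNReal.coe_natCast m, ← NNReal.coe_mul, hstep]; push_cast; rfl)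
  refine (dist_triangle_right _ _ (eulerCurve X (m * n) t f)).trans
    (add_le_add (refine_le hn hm) ?_)
  rw [mul_comm m n]
  exact refine_le hm hn

theorem cauchySeq_eulerCurve (hS : SpreadOn X L U) (hE : EulerDefectOn X L U)
    (hf : TrappedIn X L U f) {t : ℝ≥0} (ht : L * t ≤ 1) :
    CauchySeq fun n => eulerCurve X n t f := by
  refine Metric.cauchySeq_iff'.2 fun ε hε => ?_
  have hsmall : ∀ᶠ N : ℕ in atTop, 6 * ((t : ℝ) / N) < ε :=
    ((tendsto_const_div_atTop_nhds_zero_nat (t : ℝ)).const_mul 6).eventually_lt_const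
      (by simpa using hε)
  obtain ⟨N, hN, hN0⟩ := (hsmall.and (eventually_gt_atTop 0)).exists
  refine ⟨N, fun n hn => ?_⟩
  have hnN : (t : ℝ) / n ≤ t / N := by gcongr
  linarith [dist_eulerCurve_le hS hE hf (hN0.trans_le hn).ne' hN0.ne' ht]

theorem exists_isEulerLimit [CompleteSpace M] (h0 : ∀ f, X 0 f = f) (hS : SpreadOn X L U)
    (hE : EulerDefectOn X L U) (hf : TrappedIn X L U f) : ∃ σ, IsEulerLimit X L f σ := by
  have hlim : ∀ t, ∃ y, L * t ≤ 1 → Tendsto (fun n => eulerCurve X n t f) atTop (𝓝 y) := by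
    intro t
    by_cases ht : L * t ≤ 1
    · exact (cauchySeq_tendsto_of_complete (cauchySeq_eulerCurve hS hE hf ht)).imp
        fun _ hy _ => hy
    · exact ⟨f, fun h => absurd h ht⟩
  choose σ hσ using hlim
  have hdist : ∀ n ≠ 0, ∀ t, L * t ≤ 1 → dist (eulerCurve X n t f) (σ t) ≤ 3 * (t / n) := by
    intro n hn t ht
    refine le_of_tendsto_of_tendsto (tendsto_const_nhds.dist (hσ t ht)) (b := atTop)
      (g := fun m : ℕ => 3 * ((t : ℝ) / n) + 3 * (t / m)) ?_ ?_
    · simpa using ((tendsto_const_div_atTop_nhds_zero_nat (t : ℝ)).const_mul 3).const_add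
        (3 * ((t : ℝ) / n))
    · filter_upwards [eventually_ne_atTop 0] with m hm
      exact dist_eulerCurve_le hS hE hf hn hm ht
  refine ⟨σ, fun k h hk => ?_⟩
  rcases eq_or_ne k 0 with rfl | hk0
  · have := hdist 1 one_ne_zero 0 (by simp)
    simp only [eulerCurve, zero_div, Function.iterate_one, h0, NNReal.coe_zero, mul_zero] at this
    simpa using this.trans (by positivity : (0 : ℝ) ≤ 3 * h)
  · simpa [eulerCurve, hk0] using hdist k hk0 (k * h) hk

theorem IsArcField.continuousOn_eulerCurve (hX : IsArcField X) (n : ℕ) (f : M) :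
    ContinuousOn (fun t => eulerCurve X n t f) {t | t ≤ 1} := by
  have hdiv : ∀ t ∈ {t : ℝ≥0 | t ≤ 1}, t / n ≤ 1 := fun t ht => by
    rcases n.eq_zero_or_pos with rfl | hn
    · simp
    · exact (div_le_self zero_le (by exact_mod_cast hn)).trans ht
  have hiter : ∀ k : ℕ, ContinuousOn (fun t : ℝ≥0 => (X (t / n))^[k] f) {t | t ≤ 1} := by
    intro k
    induction k with
    | zero => exact continuousOn_const
    | succ k ih =>
      simp only [Function.iterate_succ_apply']
      exact hX.1.comp (f := fun t : ℝ≥0 => ((X (t / n))^[k] f, t / n)) (by fun_prop)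
        hdiv
  exact hiter n

theorem IsEulerLimit.zero {σ : ℝ≥0 → M} (h : IsEulerLimit X L f σ) : σ 0 = f := by
  simpa [eq_comm] using h 0 0 (by simp)

theorem IsEulerLimit.continuousOn {σ : ℝ≥0 → M} (hX : IsArcField X) (hL : 1 ≤ L)
    (h : IsEulerLimit X L f σ) : ContinuousOn σ {t | L * t ≤ 1} := by
  have hle : {t : ℝ≥0 | L * t ≤ 1} ⊆ {t | t ≤ 1} := fun t ht =>
    (le_mul_of_one_le_left zero_le hL).trans ht
  refine TendstoUniformlyOn.continuousOn (F := fun n t => eulerCurve X n t f) (p := atTop)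
    (Metric.tendstoUniformlyOn_iff.2 fun ε hε => ?_)
    (Frequently.of_forall fun n => (hX.continuousOn_eulerCurve n f).mono hle)
  filter_upwards [(tendsto_const_div_atTop_nhds_zero_nat (3 : ℝ)).eventually_lt_const hε,
    eventually_ne_atTop 0] with n hn hn0 t ht
  have hdist := h n (t / n) (by rwa [mul_div_cancel₀ _ (by exact_mod_cast hn0)])
  rw [mul_div_cancel₀ _ (by exact_mod_cast hn0), dist_comm] at hdist
  refine hdist.trans_lt (lt_of_le_of_lt ?_ hn)
  have ht1 : (t : ℝ) ≤ 1 := by exact_mod_cast hle ht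
  push_cast
  rw [mul_div_assoc']
  gcongr
  linarith

theorem IsEulerLimit.tendsto_iterate {σ : ℝ≥0 → M} (hX : IsArcField X) (hL : 1 ≤ L)
    (hσ : IsEulerLimit X L f σ) {t : ℝ≥0} (ht : L * t ≤ 1) {k : ℕ → ℕ} {h : ℕ → ℝ≥0}
    (hh : Tendsto h atTop (𝓝 0)) (hkh : Tendsto (fun n => k n * h n) atTop (𝓝 t))
    (hle : ∀ n, L * (k n * h n) ≤ 1) :
    Tendsto (fun n => (X (h n))^[k n] f) atTop (𝓝 (σ t)) := by
  have hσt : Tendsto (fun n => σ (k n * h n)) atTop (𝓝 (σ t)) :=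
    (hσ.continuousOn hX hL t ht).tendsto.comp (tendsto_nhdsWithin_iff.2 ⟨hkh, .of_forall hle⟩)
  refine hσt.congr_dist (squeeze_zero (fun _ => dist_nonneg)
    (fun n => (dist_comm _ _).trans_le (hσ (k n) (h n) (hle n))) ?_)
  simpa using (NNReal.tendsto_coe.2 hh).const_mul 3

theorem exists_seq_natCast_mul_tendsto {h : ℕ → ℝ≥0} (hh : Tendsto h atTop (𝓝 0))
    (hpos : ∀ n, 0 < h n) (t : ℝ≥0) :
    ∃ k : ℕ → ℕ, (∀ n, k n * h n ≤ t) ∧ Tendsto (fun n => k n * h n) atTop (𝓝 t) := by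
  have hle : ∀ n, ⌊t / h n⌋₊ * h n ≤ t := fun n =>
    (le_div_iff₀ (hpos n)).1 (Nat.floor_le zero_le)
  refine ⟨fun n => ⌊t / h n⌋₊, hle, tendsto_of_tendsto_of_tendsto_of_le_of_le
    (g := fun n => t - h n) (by simpa using tendsto_const_nhds.sub hh) tendsto_const_nhds
    (fun n => ?_) hle⟩
  rw [tsub_le_iff_right, ← add_one_mul, ← div_le_iff₀ (hpos n)]
  exact (Nat.lt_floor_add_one _).le

theorem IsEulerLimit.dist_arc_le {σ : ℝ≥0 → M} (hX : IsArcField X) (hL : 1 ≤ L)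
    (hE : EulerDefectOn X L U) (hf : TrappedIn X L U f) (hσ : IsEulerLimit X L f σ) {t s : ℝ≥0}
    (hts : L * (t + s) ≤ 1) : dist (σ (t + s)) (X s (σ t)) ≤ L * s ^ 2 := by
  rcases eq_zero_or_pos s with rfl | hs
  · simp [hX.2]
  have ht : L * t ≤ 1 := (mul_le_mul_right (le_add_of_nonneg_right zero_le) L).trans hts
  have hLs : L * s ≤ 1 := (mul_le_mul_right (le_add_of_nonneg_left zero_le) L).trans hts
  -- Steps `h n` dividing `s`, so that a polygon reaching time `t` can be continued to `t + s`.
  obtain ⟨h, hpos, hmul, hh⟩ : ∃ h : ℕ → ℝ≥0, (∀ n, 0 < h n) ∧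
      (∀ n, ((n + 1 : ℕ) : ℝ≥0) * h n = s) ∧ Tendsto h atTop (𝓝 0) :=
    ⟨fun n => s / (n + 1 : ℕ), fun n => by positivity, fun n => mul_div_cancel₀ _ (by positivity),
      (tendsto_const_div_atTop_nhds_zero_nat s).comp (tendsto_add_atTop_nat 1)⟩
  obtain ⟨k, hkt, hk⟩ := exists_seq_natCast_mul_tendsto hh hpos t
  have hkle : ∀ n, L * (k n * h n) ≤ 1 := fun n => (mul_le_mul_right (hkt n) L).trans ht
  have hsum : ∀ n, ((n + 1 + k n : ℕ) : ℝ≥0) * h n = k n * h n + s := fun n => by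
    rw [Nat.cast_add, add_mul, hmul, add_comm]
  have hlim_add : Tendsto (fun n => (X (h n))^[n + 1 + k n] f) atTop (𝓝 (σ (t + s))) := by
    refine hσ.tendsto_iterate hX hL hts hh (by simpa only [hsum] using hk.add_const s) fun n => ?_
    rw [hsum]
    exact (mul_le_mul_right (by gcongr; exact hkt n) L).trans hts
  have hlim_arc : Tendsto (fun n => X s ((X (h n))^[k n] f)) atTop (𝓝 (X s (σ t))) :=
    ((hX.continuous_arc ((le_mul_of_one_le_left zero_le hL).trans hLs)).tendsto _).comp
      (hσ.tendsto_iterate hX hL ht hh hk hkle)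
  refine le_of_tendsto (hlim_add.dist hlim_arc) (.of_forall fun n => ?_)
  have hdefect := hE _ (hf (k n) (h n) (hkle n)) (n + 1) (h n) (by rwa [hmul])
  rw [hmul, dist_comm, ← NNReal.coe_natCast, ← NNReal.coe_mul, hmul] at hdefect
  rwa [Function.iterate_add_apply]

theorem forwardTangentAt_of_dist_le {σ : ℝ≥0 → M} {t : ℝ≥0} {C : ℝ}
    (h : ∀ᶠ s in 𝓝[>] 0, dist (σ (t + s)) (X s (σ t)) ≤ C * s ^ 2) : ForwardTangentAt X σ t := by
  have hlim : Tendsto (fun s : ℝ≥0 => C * s) (𝓝[>] 0) (𝓝 0) :=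
    (Continuous.tendsto' (by fun_prop) _ _ (by simp)).mono_left nhdsWithin_le_nhds
  refine squeeze_zero' (.of_forall fun _ => by positivity) ?_ hlim
  filter_upwards [h, self_mem_nhdsWithin] with s hs hs0
  rw [div_le_iff₀ (by exact_mod_cast hs0)]
  linarith

theorem IsEulerLimit.isSolution {σ : ℝ≥0 → M} (hX : IsArcField X) (hL : 1 ≤ L)
    (hE : EulerDefectOn X L U) (hf : TrappedIn X L U f) (hσ : IsEulerLimit X L f σ) :
    IsSolution X σ (L⁻¹ : ℝ≥0) := by
  intro t ht
  have htL : L * t < 1 := by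
    rwa [ENNReal.coe_lt_coe, ← one_div, lt_div_iff₀' (one_pos.trans_le hL)] at ht
  have hopen : IsOpen {u : ℝ≥0 | L * u < 1} := isOpen_lt (by fun_prop) continuous_const
  refine ⟨(hσ.continuousOn hX hL).continuousAt
    (mem_of_superset (hopen.mem_nhds htL) fun u (hu : L * u < 1) => hu.le),
    forwardTangentAt_of_dist_le (C := L) (nhdsWithin_le_nhds ?_)⟩
  have hev : ∀ᶠ s in 𝓝 (0 : ℝ≥0), L * (t + s) < 1 :=
    Tendsto.eventually_lt_const (v := L * t) htL (Continuous.tendsto' (by fun_prop) _ _ (by simp))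
  filter_upwards [hev] with s hs using hσ.dist_arc_le hX hL hE hf hs.le

theorem exists_isSolution_near [CompleteSpace M] (hX : IsArcField X) (h1 : CondE1 X)
    (h2 : CondE2 X) (p : M) : ∃ L > 0, ∃ U ∈ 𝓝 p, ∀ f ∈ U, ∃ σ, σ 0 = f ∧
      IsSolution X σ (L⁻¹ : ℝ≥0) ∧ ∀ h, L * h ≤ 1 → dist (σ h) (X h f) ≤ L * h ^ 2 := by
  obtain ⟨L₁, U₁, hU₁, hS⟩ := h1.exists_spreadOn p
  obtain ⟨L₂, U₂, hU₂, hE⟩ := exists_eulerDefectOn hX h1 h2 p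
  obtain ⟨L₃, W, hW, hT⟩ := exists_trappedIn hX h1 h2 (inter_mem hU₁ hU₂)
  set L := max 1 (max L₁ (max L₂ L₃))
  have hL₁ : L₁ ≤ L := (le_max_left _ _).trans (le_max_right _ _)
  have hL₂ : L₂ ≤ L := ((le_max_left _ _).trans (le_max_right _ _)).trans (le_max_right _ _)
  have hL₃ : L₃ ≤ L := ((le_max_right _ _).trans (le_max_right _ _)).trans (le_max_right _ _)
  have hS' := hS.mono hL₁ (Set.inter_subset_left (t := U₂))
  have hE' := hE.mono hL₂ (Set.inter_subset_right (s := U₁))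
  refine ⟨L, one_pos.trans_le (le_max_left _ _), W, hW, fun f hf => ?_⟩
  have hf' := (hT f hf).mono hL₃
  obtain ⟨σ, hσ⟩ := exists_isEulerLimit hX.2 hS' hE' hf'
  refine ⟨σ, hσ.zero, hσ.isSolution hX (le_max_left _ _) hE' hf', fun h hh => ?_⟩
  have hdist := hσ.dist_arc_le hX (le_max_left _ _) hE' hf' (t := 0) (s := h) (by rwa [zero_add])
  rwa [zero_add, hσ.zero] at hdist

end LocalExistence

section Solutions

variable {M : Type*} [MetricSpace M] {X : ℝ≥0 → M → M} {σ τ : ℝ≥0 → M} {c d : ℝ≥0∞}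

theorem ForwardTangentAt.congr {t : ℝ≥0} (h : ForwardTangentAt X σ t) (heq : σ =ᶠ[𝓝 t] τ) :
    ForwardTangentAt X τ t := by
  have hadd : Tendsto (fun h : ℝ≥0 => t + h) (𝓝[>] 0) (𝓝 t) :=
    (Continuous.tendsto' (by fun_prop) _ _ (add_zero t)).mono_left nhdsWithin_le_nhds
  refine Tendsto.congr' ?_ h
  filter_upwards [hadd.eventually heq] with h hh
  rw [hh, heq.self_of_nhds]

theorem IsSolutionAt.congr {t : ℝ≥0} (h : IsSolutionAt X σ t) (heq : σ =ᶠ[𝓝 t] τ) :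
    IsSolutionAt X τ t :=
  ⟨h.1.congr heq, h.2.congr heq⟩

theorem IsSolutionAt.comp_add {s t : ℝ≥0} (h : IsSolutionAt X σ (s + t)) :
    IsSolutionAt X (fun u => σ (s + u)) t :=
  ⟨ContinuousAt.comp' h.1 (by fun_prop), by simpa [ForwardTangentAt, add_assoc] using h.2⟩

theorem IsSolutionAt.comp_tsub {s t : ℝ≥0} (h : IsSolutionAt X σ (t - s)) (hst : s ≤ t) :
    IsSolutionAt X (fun u => σ (u - s)) t :=
  ⟨ContinuousAt.comp' h.1 (by fun_prop),
    by simpa only [ForwardTangentAt, tsub_add_eq_add_tsub hst] using h.2⟩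

theorem IsSolution.comp_add (h : IsSolution X σ c) (s : ℝ≥0) :
    IsSolution X (fun u => σ (s + u)) (c - s) := by
  refine fun u hu => (h _ ?_).comp_add
  rwa [ENNReal.coe_add, add_comm, ← lt_tsub_iff_right]

theorem isOpen_setOf_coe_lt (c : ℝ≥0∞) : IsOpen {t : ℝ≥0 | (t : ℝ≥0∞) < c} :=
  isOpen_lt ENNReal.continuous_coe continuous_const

theorem coe_lt_of_le_of_coe_lt {s t : ℝ≥0} (hst : s ≤ t) (ht : (t : ℝ≥0∞) < c) :
    (s : ℝ≥0∞) < c :=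
  (ENNReal.coe_le_coe.2 hst).trans_lt ht

theorem IsSolution.continuousOn_Icc (h : IsSolution X σ c) {t : ℝ≥0} (ht : (t : ℝ≥0∞) < c) :
    ContinuousOn σ (Set.Icc 0 t) :=
  fun u hu => (h u (coe_lt_of_le_of_coe_lt hu.2 ht)).1.continuousWithinAt

theorem SpreadOn.eventually_dist_lt {L t : ℝ≥0} {U : Set M} (hS : SpreadOn X L U)
    (hσ : ForwardTangentAt X σ t) (hτ : ForwardTangentAt X τ t) (hσU : σ t ∈ U) (hτU : τ t ∈ U)
    {q : ℝ} (hq : L * dist (σ t) (τ t) < q) :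
    ∀ᶠ h : ℝ≥0 in 𝓝[>] 0, dist (σ (t + h)) (τ (t + h)) < dist (σ t) (τ t) + q * h := by
  have hlim := hσ.add hτ
  rw [add_zero] at hlim
  have hL : ∀ᶠ h : ℝ≥0 in 𝓝[>] 0, L * h ≤ 1 := nhdsWithin_le_nhds
    (Tendsto.eventually_le_const (v := 0) one_pos
      (Continuous.tendsto' (by fun_prop) _ _ (mul_zero L)))
  filter_upwards [hlim.eventually_lt_const (sub_pos.2 hq), hL, self_mem_nhdsWithin]
    with h hh hLh hh0
  rw [← add_div, div_lt_iff₀ (by exact_mod_cast hh0)] at hh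
  linarith [hS _ hσU _ hτU h hLh,
    dist_triangle4_right (σ (t + h)) (τ (t + h)) (X h (σ t)) (X h (τ t))]

theorem IsSolution.dist_le {L t : ℝ≥0} {r : ℝ} (hσ : IsSolution X σ c) (hτ : IsSolution X τ d)
    (hc : (t : ℝ≥0∞) < c) (hd : (t : ℝ≥0∞) < d)
    (hS : ∀ u ≤ t, SpreadOn X L (Metric.ball (σ u) r))
    (hr : dist (σ 0) (τ 0) * Real.exp (L * t) < r) :
    dist (σ t) (τ t) ≤ dist (σ 0) (τ 0) * Real.exp (L * t) := by
  have hr0 : 0 < r := lt_of_le_of_lt (by positivity) hr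
  have hcont : ContinuousOn (fun u => dist (σ u) (τ u)) (Set.Icc 0 t) :=
    continuous_dist.comp_continuousOn ((hσ.continuousOn_Icc hc).prodMk (hτ.continuousOn_Icc hd))
  -- Truncating at `r` makes the differential inequality hold at all times, also when the curves
  -- are far apart.
  have key := le_gronwallBound_of_forall_eventually_lt (φ := fun u => min (dist (σ u) (τ u)) r)
    (K := L) (ε := 0) (b := t) (hcont.inf continuousOn_const) ?_ t le_rfl
  · rw [gronwallBound_ε0] at key
    have hmin : min (dist (σ t) (τ t)) r ≤ dist (σ 0) (τ 0) * Real.exp (L * t) :=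
      key.trans (by gcongr; exact min_le_left _ _)
    exact (min_le_iff.1 hmin).resolve_right hr.not_ge
  · intro u hu q hq
    rw [add_zero] at hq
    rcases le_or_gt r (dist (σ u) (τ u)) with hfar | hnear
    · filter_upwards [self_mem_nhdsWithin] with h hh
      rw [min_eq_right hfar] at hq ⊢
      have hq0 : 0 < q := lt_of_le_of_lt (by positivity) hq
      have hh0 : (0 : ℝ) < h := by exact_mod_cast hh
      linarith [min_le_right (dist (σ (u + h)) (τ (u + h))) r, mul_pos hq0 hh0]
    · rw [min_eq_left hnear.le] at hq ⊢
      have hτu : τ u ∈ Metric.ball (σ u) r := by rwa [Metric.mem_ball, dist_comm]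
      filter_upwards [(hS u hu.le).eventually_dist_lt (hσ u (coe_lt_of_le_of_coe_lt hu.le hc)).2
        (hτ u (coe_lt_of_le_of_coe_lt hu.le hd)).2 (Metric.mem_ball_self hr0) hτu hq] with h hh
      exact (min_le_left _ _).trans_lt hh

theorem IsSolution.eq (h1 : CondE1 X) (hσ : IsSolution X σ c) (hτ : IsSolution X τ d)
    (h0 : σ 0 = τ 0) {t : ℝ≥0} (hc : (t : ℝ≥0∞) < c) (hd : (t : ℝ≥0∞) < d) : σ t = τ t := by
  obtain ⟨L, r, hr, hS⟩ :=
    h1.exists_spreadOn_ball (isCompact_Icc.image_of_continuousOn (hσ.continuousOn_Icc hc))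
  have hdist := hσ.dist_le hτ hc hd (fun u hu => hS _ ⟨u, ⟨zero_le, hu⟩, rfl⟩) (by simpa [h0])
  simpa [h0] using hdist

theorem IsSolution.dist_le_gronwallBound {A K : ℝ} {t : ℝ≥0} {q : M} (hσ : IsSolution X σ c)
    (ht : (t : ℝ≥0∞) < c)
    (hspeed : ∀ u ≤ t, ∀ s ≤ 1, dist (X s (σ u)) (σ u) ≤ s * (A + K * dist (σ u) q)) :
    dist (σ t) q ≤ gronwallBound (dist (σ 0) q) K A t := by
  refine le_gronwallBound_of_forall_eventually_lt (φ := fun u => dist (σ u) q)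
    (continuous_dist.comp_continuousOn
      ((hσ.continuousOn_Icc ht).prodMk continuousOn_const)) ?_ t le_rfl
  intro u hu r hr
  filter_upwards [(hσ u (coe_lt_of_le_of_coe_lt hu.le ht)).2.eventually_lt_const (sub_pos.2 hr),
    nhdsWithin_le_nhds (ge_mem_nhds one_pos), self_mem_nhdsWithin] with h hh h1 hh0
  rw [div_lt_iff₀ (by exact_mod_cast hh0)] at hh
  linarith [hspeed u hu.le h h1, dist_triangle4 (σ (u + h)) (X h (σ u)) (σ u) q]

theorem IsSolution.lipschitzOnWith {C : ℝ≥0} (hσ : IsSolution X σ c)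
    (hspeed : ∀ u : ℝ≥0, (u : ℝ≥0∞) < c → ∀ s ≤ 1, dist (X s (σ u)) (σ u) ≤ s * C) :
    LipschitzOnWith C σ {u | (u : ℝ≥0∞) < c} := by
  have hle : ∀ s t : ℝ≥0, s ≤ t → (t : ℝ≥0∞) < c → dist (σ s) (σ t) ≤ C * dist s t := by
    intro s t hst ht
    obtain ⟨u, rfl⟩ := exists_add_of_le hst
    have hu : (u : ℝ≥0∞) < c - s := by rwa [lt_tsub_iff_right, ← ENNReal.coe_add, add_comm]
    have key := (hσ.comp_add s).dist_le_gronwallBound hu (A := C) (K := 0) (q := σ s)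
      fun v hv h h1 => by
        simpa using hspeed (s + v) (coe_lt_of_le_of_coe_lt (by gcongr) ht) h h1
    rw [dist_comm]
    simpa [gronwallBound_K0, NNReal.dist_eq] using key
  refine LipschitzOnWith.of_dist_le_mul fun s hs t ht => ?_
  rcases le_total s t with hst | hts
  · exact hle s t hst ht
  · rw [dist_comm, dist_comm s]
    exact hle t s hts hs

end Solutions

section MaximalFlow

variable {M : Type*} [MetricSpace M] {X : ℝ≥0 → M → M} {σ : ℝ≥0 → M} {c : ℝ≥0∞} {f : M}
  {s t : ℝ≥0}

/-- The supremum of the times up to which an integral curve of `X` from `f` exists. -/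
noncomputable def lifetime (X : ℝ≥0 → M → M) (f : M) : ℝ≥0∞ :=
  sSup {c | ∃ σ : ℝ≥0 → M, σ 0 = f ∧ IsSolution X σ c}

open Classical in
/-- The value at time `t` of an integral curve of `X` from `f`, and the junk value `f` from the
lifetime of `f` on. -/
noncomputable def maxFlow (X : ℝ≥0 → M → M) (t : ℝ≥0) (f : M) : M :=
  if h : ∃ σ : ℝ≥0 → M, σ 0 = f ∧ ∃ c : ℝ≥0∞, (t : ℝ≥0∞) < c ∧ IsSolution X σ c then h.choose t
  else f

theorem IsSolution.le_lifetime (h : IsSolution X σ c) : c ≤ lifetime X (σ 0) :=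
  le_sSup ⟨σ, rfl, h⟩

theorem maxFlow_zero (f : M) : maxFlow X 0 f = f := by
  unfold maxFlow
  split_ifs with h
  · exact h.choose_spec.1
  · rfl

theorem IsSolution.maxFlow_eq (h1 : CondE1 X) (hσ : IsSolution X σ c) (ht : (t : ℝ≥0∞) < c) :
    maxFlow X t (σ 0) = σ t := by
  have h : ∃ τ : ℝ≥0 → M, τ 0 = σ 0 ∧ ∃ c : ℝ≥0∞, (t : ℝ≥0∞) < c ∧ IsSolution X τ c :=
    ⟨σ, rfl, c, ht, hσ⟩
  obtain ⟨h0, d, hd, hsol⟩ := h.choose_spec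
  rw [maxFlow, dif_pos h]
  exact hsol.eq h1 hσ h0 hd ht

theorem isSolution_maxFlow (h1 : CondE1 X) (f : M) :
    IsSolution X (fun u => maxFlow X u f) (lifetime X f) := by
  intro t ht
  obtain ⟨c, ⟨σ, rfl, hσ⟩, hc⟩ := lt_sSup_iff.1 ht
  refine (hσ t hc).congr ?_
  filter_upwards [(isOpen_setOf_coe_lt c).mem_nhds hc] with u hu
  exact (hσ.maxFlow_eq h1 hu).symm

theorem maxFlow_maxFlow (h1 : CondE1 X) (hst : ((s + t : ℝ≥0) : ℝ≥0∞) < lifetime X f) :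
    maxFlow X t (maxFlow X s f) = maxFlow X (s + t) f := by
  have ht : (t : ℝ≥0∞) < lifetime X f - s := by
    rwa [lt_tsub_iff_right, ← ENNReal.coe_add, add_comm]
  simpa using ((isSolution_maxFlow h1 f).comp_add s).maxFlow_eq h1 ht

theorem add_lifetime_maxFlow_le (h1 : CondE1 X) (hs : (s : ℝ≥0∞) < lifetime X f) :
    s + lifetime X (maxFlow X s f) ≤ lifetime X f := by
  set g := maxFlow X s f with hg
  set ρ : ℝ≥0 → M := fun u => if u ≤ s then maxFlow X u f else maxFlow X (u - s) g with hρ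
  have hρ_eq : ∀ u : ℝ≥0, (u : ℝ≥0∞) < lifetime X f → ρ u = maxFlow X u f := by
    intro u hu
    rcases le_or_gt u s with hus | hus
    · exact if_pos hus
    · rw [hρ, hg]
      dsimp only
      rw [if_neg hus.not_ge, maxFlow_maxFlow h1 (by rwa [add_tsub_cancel_of_le hus.le]),
        add_tsub_cancel_of_le hus.le]
  have hsol : IsSolution X ρ (s + lifetime X g) := by
    intro t ht
    rcases le_or_gt t s with hts | hts
    · refine (isSolution_maxFlow h1 f t (coe_lt_of_le_of_coe_lt hts hs)).congr ?_
      filter_upwards [(isOpen_setOf_coe_lt _).mem_nhds (coe_lt_of_le_of_coe_lt hts hs)] with u hu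
      exact (hρ_eq u hu).symm
    · have htg : ((t - s : ℝ≥0) : ℝ≥0∞) < lifetime X g := by
        rw [ENNReal.coe_sub]
        exact ENNReal.sub_lt_of_lt_add (by exact_mod_cast hts.le) (by rwa [add_comm])
      refine ((isSolution_maxFlow h1 g _ htg).comp_tsub hts.le).congr ?_
      filter_upwards [lt_mem_nhds hts] with u hu
      exact (if_neg hu.not_ge).symm
  simpa [hρ, maxFlow_zero] using hsol.le_lifetime

theorem le_lifetime_of_forall_le (h1 : CondE1 X) (hc : 0 < c) (hf : 0 < lifetime X f)
    (h : ∀ s < t, (s : ℝ≥0∞) < lifetime X f → c ≤ lifetime X (maxFlow X s f)) :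
    t ≤ lifetime X f := by
  by_contra! hlt
  have hne : lifetime X f ≠ ∞ := hlt.ne_top
  obtain ⟨s, hs, hsf⟩ :=
    ENNReal.lt_iff_exists_nnreal_btwn.1 (ENNReal.sub_lt_self hne hf.ne' hc.ne')
  have hle : s + c ≤ lifetime X f :=
    (add_le_add_right (h s (by exact_mod_cast hsf.trans hlt) hsf) _).trans
      (add_lifetime_maxFlow_le h1 hsf)
  exact hle.not_gt (ENNReal.lt_add_of_sub_lt_right (.inl hne) hs)

theorem IsLocalFlowOf.isSolution {T : M → ℝ≥0∞} {F : ℝ≥0 → M → M} (h : IsLocalFlowOf X T F)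
    (f : M) : IsSolution X (fun u => F u f) (T f) :=
  fun t ht => ⟨ContinuousAt.comp' (f := fun u : ℝ≥0 => (f, u))
    (h.continuousOn.continuousAt (h.isOpen_domain.mem_nhds ht)) (by fun_prop), h.tangent f t ht⟩

theorem IsLocalFlowOf.le_lifetime {T : M → ℝ≥0∞} {F : ℝ≥0 → M → M} (h : IsLocalFlowOf X T F)
    (f : M) : T f ≤ lifetime X f := by
  simpa only [h.zero] using (h.isSolution f).le_lifetime

theorem IsLocalFlowOf.eq_maxFlow (h1 : CondE1 X) {T : M → ℝ≥0∞} {F : ℝ≥0 → M → M}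
    (h : IsLocalFlowOf X T F) (ht : (t : ℝ≥0∞) < T f) : F t f = maxFlow X t f := by
  simpa only [h.zero] using ((h.isSolution f).maxFlow_eq h1 ht).symm

theorem IsFlowOf.isLocalFlowOf {F : ℝ≥0 → M → M} (h : IsFlowOf X F) :
    IsLocalFlowOf X (fun _ => ∞) F where
  pos _ := ENNReal.zero_lt_top
  isOpen_domain := by simp
  continuousOn := h.continuous.continuousOn
  zero := h.zero
  add f s t _ _ _ := h.add f s t
  tangent f t _ := h.tangent f t

theorem IsFlowOf.eq_maxFlow (h1 : CondE1 X) {F : ℝ≥0 → M → M} (h : IsFlowOf X F) :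
    F = maxFlow X :=
  funext fun _ => funext fun _ => h.isLocalFlowOf.eq_maxFlow h1 ENNReal.coe_lt_top

theorem IsLocalFlowOf.isFlowOf {T : M → ℝ≥0∞} {F : ℝ≥0 → M → M} (h : IsLocalFlowOf X T F)
    (hT : ∀ f, T f = ∞) : IsFlowOf X F where
  continuous := by simpa [hT] using h.continuousOn
  zero := h.zero
  add f s t := h.add f s t (by simp [hT]) (by simp [hT]) (by simp [hT])
  tangent f t := h.tangent f t (by simp [hT])

end MaximalFlow

section LocalFlow

variable {M : Type*} [MetricSpace M] {X : ℝ≥0 → M → M} {L L' : ℝ≥0} {U U' : Set M} {f g : M}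
  {b t : ℝ≥0} {r : ℝ}

/-- On `U` the maximal flow exists up to the time `1 / L` and deviates from the arcs quadratically
in time. -/
def FlowBoxOn (X : ℝ≥0 → M → M) (L : ℝ≥0) (U : Set M) : Prop :=
  ∀ f ∈ U, ∀ h, L * h ≤ 1 →
    (h : ℝ≥0∞) < lifetime X f ∧ dist (maxFlow X h f) (X h f) ≤ L * h ^ 2

theorem FlowBoxOn.mono (hL : L ≤ L') (hU : U' ⊆ U) (h : FlowBoxOn X L U) : FlowBoxOn X L' U' :=
  fun f hf t ht => (h f (hU hf) t ((mul_le_mul_left hL t).trans ht)).imp_right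
    fun hdist => hdist.trans (by gcongr)

theorem FlowBoxOn.lt_lifetime (h : FlowBoxOn X L U) (hf : f ∈ U) :
    (((L + 1)⁻¹ : ℝ≥0) : ℝ≥0∞) < lifetime X f := by
  refine (h f hf _ ?_).1
  rw [← div_eq_mul_inv]
  exact div_le_one_of_le₀ (le_add_of_nonneg_right zero_le) zero_le

theorem exists_flowBoxOn [CompleteSpace M] (hX : IsArcField X) (h1 : CondE1 X) (h2 : CondE2 X)
    (p : M) : ∃ L, ∃ U ∈ 𝓝 p, FlowBoxOn X L U := by
  obtain ⟨L, hL, U, hU, h⟩ := exists_isSolution_near hX h1 h2 p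
  refine ⟨2 * L, U, hU, fun f hf t ht => ?_⟩
  obtain ⟨σ, rfl, hσ, hdist⟩ := h f hf
  have hLt : L * t < 1 := by
    rcases eq_zero_or_pos t with rfl | ht0
    · simp
    · exact (lt_mul_of_one_lt_left (mul_pos hL ht0) one_lt_two).trans_le (by rwa [← mul_assoc])
  have htL : (t : ℝ≥0∞) < (L⁻¹ : ℝ≥0) := by
    rwa [ENNReal.coe_lt_coe, ← one_div, lt_div_iff₀' hL]
  refine ⟨htL.trans_le hσ.le_lifetime, ?_⟩
  rw [hσ.maxFlow_eq h1 htL]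
  refine (hdist t hLt.le).trans ?_
  gcongr
  exact le_mul_of_one_le_left zero_le one_le_two

/-- `X` spreads at rate `L` and its maximal flow exists up to the time `1 / L` on all balls of
radius `r` around the orbit of `f` up to time `b`. -/
def OrbitTube (X : ℝ≥0 → M → M) (L : ℝ≥0) (r : ℝ) (b : ℝ≥0) (f : M) : Prop :=
  ∀ u ≤ b, SpreadOn X L (Metric.ball (maxFlow X u f) r) ∧
    FlowBoxOn X L (Metric.ball (maxFlow X u f) r)

theorem exists_orbitTube [CompleteSpace M] (hX : IsArcField X) (h1 : CondE1 X) (h2 : CondE2 X)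
    (hb : (b : ℝ≥0∞) < lifetime X f) : ∃ L, ∃ r > 0, OrbitTube X L r b f := by
  have horbit : IsCompact ((fun u => maxFlow X u f) '' Set.Icc 0 b) :=
    isCompact_Icc.image_of_continuousOn ((isSolution_maxFlow h1 f).continuousOn_Icc hb)
  have hloc : ∀ p, ∃ L, ∃ U ∈ 𝓝 p, SpreadOn X L U ∧ FlowBoxOn X L U := by
    intro p
    obtain ⟨L, U, hU, hS⟩ := h1.exists_spreadOn p
    obtain ⟨L', U', hU', hB⟩ := exists_flowBoxOn hX h1 h2 p
    exact ⟨max L L', U ∩ U', inter_mem hU hU', hS.mono (le_max_left _ _) Set.inter_subset_left,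
      hB.mono (le_max_right _ _) Set.inter_subset_right⟩
  obtain ⟨L, r, hr, h⟩ := exists_forall_ball_of_isCompact
    (fun hL hU h => ⟨h.1.mono hL hU, h.2.mono hL hU⟩) hloc horbit
  exact ⟨L, r, hr, fun u hu => h _ ⟨u, ⟨zero_le, hu⟩, rfl⟩⟩

theorem OrbitTube.dist_maxFlow_le (h1 : CondE1 X) (h : OrbitTube X L r b f)
    (hr : dist f g * Real.exp (L * b) < r) (htb : t ≤ b) (hf : (t : ℝ≥0∞) < lifetime X f)
    (hg : (t : ℝ≥0∞) < lifetime X g) :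
    dist (maxFlow X t f) (maxFlow X t g) ≤ dist f g * Real.exp (L * b) := by
  have hexp : dist f g * Real.exp (L * t) ≤ dist f g * Real.exp (L * b) := by gcongr
  have key := (isSolution_maxFlow h1 f).dist_le (isSolution_maxFlow h1 g) hf hg
    (fun u hu => (h u (hu.trans htb)).1)
    (by simpa only [maxFlow_zero] using hexp.trans_lt hr)
  simp only [maxFlow_zero] at key
  exact key.trans hexp

theorem OrbitTube.le_lifetime (h1 : CondE1 X) (h : OrbitTube X L r b f)
    (hf : (b : ℝ≥0∞) < lifetime X f) (hr : dist f g * Real.exp (L * b) < r) :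
    (b : ℝ≥0∞) ≤ lifetime X g := by
  have hlt : ∀ u ≤ b, dist (maxFlow X u f) (maxFlow X u g) ≤ dist f g * Real.exp (L * b) →
      (((L + 1)⁻¹ : ℝ≥0) : ℝ≥0∞) < lifetime X (maxFlow X u g) := fun u hu hdist =>
    (h u hu).2.lt_lifetime (Metric.mem_ball'.2 (hdist.trans_lt hr))
  refine le_lifetime_of_forall_le h1 (c := ((L + 1)⁻¹ : ℝ≥0))
    (by exact_mod_cast inv_pos.2 (by positivity : 0 < L + 1)) ?_ fun s hs hsg =>
    (hlt s hs.le (h.dist_maxFlow_le h1 hr hs.le (coe_lt_of_le_of_coe_lt hs.le hf) hsg)).le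
  have h0 := hlt 0 zero_le (by
    simpa only [maxFlow_zero] using
      le_mul_of_one_le_right dist_nonneg (Real.one_le_exp (by positivity)))
  rw [maxFlow_zero] at h0
  exact pos_of_gt h0

theorem exists_eventually_dist_maxFlow_le [CompleteSpace M] (hX : IsArcField X) (h1 : CondE1 X)
    (h2 : CondE2 X) (ht : (t : ℝ≥0∞) < lifetime X f) :
    ∃ b > t, ∃ C : ℝ, ∀ᶠ g in 𝓝 f, ∀ u < b, (u : ℝ≥0∞) < lifetime X g ∧
      dist (maxFlow X u f) (maxFlow X u g) ≤ dist f g * C := by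
  obtain ⟨b, htb, hb⟩ := ENNReal.lt_iff_exists_nnreal_btwn.1 ht
  obtain ⟨L, r, hr, h⟩ := exists_orbitTube hX h1 h2 hb
  have hev : ∀ᶠ g in 𝓝 f, dist f g * Real.exp (L * b) < r :=
    Tendsto.eventually_lt_const hr (Continuous.tendsto' (by fun_prop) _ _ (by simp))
  refine ⟨b, by exact_mod_cast htb, Real.exp (L * b), ?_⟩
  filter_upwards [hev] with g hg u hu
  have hug : (u : ℝ≥0∞) < lifetime X g :=
    (ENNReal.coe_lt_coe.2 hu).trans_le (h.le_lifetime h1 hb hg)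
  exact ⟨hug, h.dist_maxFlow_le h1 hg hu.le (coe_lt_of_le_of_coe_lt hu.le hb) hug⟩

theorem isLocalFlowOf_maxFlow [CompleteSpace M] (hX : IsArcField X) (h1 : CondE1 X)
    (h2 : CondE2 X) : IsLocalFlowOf X (lifetime X) (maxFlow X) where
  pos f := by
    obtain ⟨L, U, hU, h⟩ := exists_flowBoxOn hX h1 h2 f
    exact pos_of_gt (h.lt_lifetime (mem_of_mem_nhds hU))
  isOpen_domain := by
    refine isOpen_iff_mem_nhds.2 fun ⟨f, t⟩ ht => ?_
    obtain ⟨b, hb, C, h⟩ := exists_eventually_dist_maxFlow_le hX h1 h2 ht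
    filter_upwards [prod_mem_nhds h (gt_mem_nhds hb)] with q hq using (hq.1 q.2 hq.2).1
  continuousOn := by
    rintro ⟨f, t⟩ ht
    obtain ⟨b, hb, C, h⟩ := exists_eventually_dist_maxFlow_le hX h1 h2 ht
    refine ContinuousAt.continuousWithinAt ?_
    have hfst : Tendsto (fun q : M × ℝ≥0 => dist f q.1 * C) (𝓝 (f, t)) (𝓝 0) :=
      Continuous.tendsto' (by fun_prop) _ _ (by simp)
    have hsnd : Tendsto (fun q : M × ℝ≥0 => maxFlow X q.2 f) (𝓝 (f, t)) (𝓝 (maxFlow X t f)) :=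
      ((isSolution_maxFlow h1 f t ht).1.tendsto.comp (continuous_snd.tendsto _))
    refine hsnd.congr_dist (squeeze_zero' (.of_forall fun _ => dist_nonneg) ?_ hfst)
    filter_upwards [prod_mem_nhds h (gt_mem_nhds hb)] with q hq using (hq.1 q.2 hq.2).2
  zero := maxFlow_zero
  add f s t _ _ hst := maxFlow_maxFlow h1 hst
  tangent f t ht := (isSolution_maxFlow h1 f t ht).2

theorem OrbitTube.dist_iterate_le (h1 : CondE1 X) {n : ℕ} {h : ℝ≥0}
    (htube : OrbitTube X L r (n * h) f) (hf : ((n * h : ℝ≥0) : ℝ≥0∞) < lifetime X f)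
    (hh : L * h ≤ 1) (hr : n * (L * h ^ 2) * Real.exp (n * (L * h)) < r) :
    dist ((X h)^[n] f) (maxFlow X (n * h) f) ≤ n * (L * h ^ 2) * Real.exp (n * (L * h)) := by
  refine le_mul_exp_of_step_le (e := fun k => dist ((X h)^[k] f) (maxFlow X (k * h) f))
    (by positivity) (by positivity) (by simp [maxFlow_zero]) (fun k hk hek => ?_) n le_rfl
  have hkn : k * h + h ≤ n * h := by
    rw [← add_one_mul]
    gcongr
    exact_mod_cast hk
  obtain ⟨hspread, hbox⟩ := htube (k * h) ((le_add_of_nonneg_right zero_le).trans hkn)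
  have hcenter := Metric.mem_ball_self (x := maxFlow X (k * h) f)
    (lt_of_le_of_lt (by positivity) hr)
  have hs := hspread _ (Metric.mem_ball.2 (hek.trans_lt hr)) _ hcenter h hh
  have hd := (hbox _ hcenter h hh).2
  rw [maxFlow_maxFlow h1 (coe_lt_of_le_of_coe_lt hkn hf)] at hd
  rw [Function.iterate_succ_apply', Nat.cast_succ, add_one_mul]
  linarith [dist_triangle_right (X h ((X h)^[k] f)) (maxFlow X (k * h + h) f)
    (X h (maxFlow X (k * h) f))]

theorem tendsto_eulerCurve_maxFlow [CompleteSpace M] (hX : IsArcField X) (h1 : CondE1 X)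
    (h2 : CondE2 X) (ht : (t : ℝ≥0∞) < lifetime X f) :
    Tendsto (fun n => eulerCurve X n t f) atTop (𝓝 (maxFlow X t f)) := by
  obtain ⟨L, r, hr, htube⟩ := exists_orbitTube hX h1 h2 ht
  have hbound : Tendsto (fun n : ℕ => n * (L * ((t / n : ℝ≥0) : ℝ) ^ 2) *
      Real.exp (n * (L * (t / n : ℝ≥0)))) atTop (𝓝 0) := by
    refine Tendsto.congr' ?_
      (tendsto_const_div_atTop_nhds_zero_nat (L * (t : ℝ) ^ 2 * Real.exp (L * t)))
    filter_upwards [eventually_ne_atTop 0] with n hn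
    push_cast
    field_simp
  have hstep : Tendsto (fun n : ℕ => L * (t / n)) atTop (𝓝 0) := by
    simpa using (tendsto_const_div_atTop_nhds_zero_nat t).const_mul L
  refine tendsto_iff_dist_tendsto_zero.2
    (squeeze_zero' (.of_forall fun _ => dist_nonneg) ?_ hbound)
  filter_upwards [eventually_ne_atTop 0, hbound.eventually_lt_const hr,
    hstep.eventually_le_const one_pos] with n hn hnr hn1
  have hnt : n * (t / n) = t := mul_div_cancel₀ _ (by exact_mod_cast hn)
  have key := OrbitTube.dist_iterate_le h1 (n := n) (h := t / n) (by rwa [hnt]) (by rwa [hnt])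
    hn1 hnr
  rwa [hnt] at key

end LocalFlow

section GlobalExistence

variable {M : Type*} [MetricSpace M] [CompleteSpace M] {X : ℝ≥0 → M → M} {f : M}

theorem lifetime_eq_top_of_lipschitzOnWith (hX : IsArcField X) (h1 : CondE1 X) (h2 : CondE2 X)
    {C : ℝ≥0}
    (hf : LipschitzOnWith C (fun u => maxFlow X u f) {u : ℝ≥0 | (u : ℝ≥0∞) < lifetime X f}) :
    lifetime X f = ∞ := by
  by_contra htop
  obtain ⟨T, hT⟩ : ∃ T : ℝ≥0, (T : ℝ≥0∞) = lifetime X f := ⟨_, ENNReal.coe_toNNReal htop⟩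
  have hT0 : 0 < T := by
    have := (isLocalFlowOf_maxFlow hX h1 h2).pos f
    rwa [← hT, ENNReal.coe_pos] at this
  obtain ⟨u, -, huT, hu⟩ := exists_seq_strictMono_tendsto' hT0
  have hlt : ∀ n, (u n : ℝ≥0∞) < lifetime X f := fun n => by
    rw [← hT, ENNReal.coe_lt_coe]
    exact (huT n).2
  obtain ⟨p, hp⟩ := cauchySeq_tendsto_of_complete (hf.cauchySeq_comp hu.cauchySeq
    (Set.range_subset_iff.2 hlt))
  obtain ⟨L, U, hU, hbox⟩ := exists_flowBoxOn hX h1 h2 p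
  have hle : ∀ᶠ n in atTop, u n + (L + 1)⁻¹ ≤ T := by
    filter_upwards [hp.eventually_mem hU] with n hn
    have := (add_le_add_right (hbox.lt_lifetime hn).le _).trans (add_lifetime_maxFlow_le h1 (hlt n))
    rw [← hT] at this
    exact_mod_cast this
  exact (le_of_tendsto (hu.add_const _) hle).not_gt
    (lt_add_of_pos_right T (inv_pos.2 (by positivity)))

theorem lifetime_eq_top_of_linear_growth (hX : IsArcField X) (h1 : CondE1 X) (h2 : CondE2 X)
    {A K : ℝ≥0} {p : M}
    (hspeed : ∀ f, ∀ t ≤ 1, dist (X t f) f ≤ t * (A + K * dist f p)) (f : M) :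
    lifetime X f = ∞ := by
  by_contra htop
  obtain ⟨T, hT⟩ : ∃ T : ℝ≥0, (T : ℝ≥0∞) = lifetime X f := ⟨_, ENNReal.coe_toNNReal htop⟩
  have hbound : ∀ u : ℝ≥0, (u : ℝ≥0∞) < lifetime X f →
      dist (maxFlow X u f) p ≤ gronwallBound (dist f p) K A T := by
    intro u hu
    have huT : u ≤ T := by exact_mod_cast hT ▸ hu.le
    have key := (isSolution_maxFlow h1 f).dist_le_gronwallBound hu (fun v _ => hspeed _)
    rw [maxFlow_zero] at key
    exact key.trans (gronwallBound_mono dist_nonneg A.coe_nonneg K.coe_nonneg huT)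
  refine htop (lifetime_eq_top_of_lipschitzOnWith hX h1 h2
    (C := A + K * (gronwallBound (dist f p) K A T).toNNReal)
    ((isSolution_maxFlow h1 f).lipschitzOnWith fun u hu s hs => (hspeed _ s hs).trans ?_))
  push_cast
  gcongr
  exact (hbound u hu).trans (Real.le_coe_toNNReal _)

end GlobalExistence

section ClipLemmas

variable {lo hi : EReal} {x d e : ℝ}

theorem coe_clip_of_le (h : lo < hi) (hx : lo ≤ x) :
    (clip lo hi x : EReal) = min (x : EReal) hi := by
  rw [coe_clip h, max_eq_right hx]

theorem coe_clip_of_ge (h : lo < hi) (hx : (x : EReal) ≤ hi) :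
    (clip lo hi x : EReal) = max lo (x : EReal) := by
  rw [coe_clip h, min_eq_left (max_le h.le hx)]

theorem clip_of_mem (h : lo < hi) (h₁ : lo ≤ x) (h₂ : (x : EReal) ≤ hi) : clip lo hi x = x := by
  rw [← EReal.coe_eq_coe_iff, coe_clip_of_le h h₁, min_eq_left h₂]

theorem clip_mono (h : lo < hi) : Monotone (clip lo hi) := by
  intro x y hxy
  rw [← EReal.coe_le_coe_iff, coe_clip h, coe_clip h]
  gcongr

theorem clip_add_le (h : lo < hi) (hd : 0 ≤ d) : clip lo hi (x + d) ≤ clip lo hi x + d := by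
  have hd' : (0 : EReal) ≤ d := by exact_mod_cast hd
  rw [← EReal.coe_le_coe_iff, EReal.coe_add, coe_clip h, coe_clip h, ← min_add_add_right,
    ← max_add_add_right, EReal.coe_add]
  gcongr <;> exact le_add_of_nonneg_right hd'

theorem dist_clip_le (h : lo < hi) (x y : ℝ) : dist (clip lo hi x) (clip lo hi y) ≤ dist x y := by
  have hlip : LipschitzWith 1 (clip lo hi) := LipschitzWith.of_le_add fun x y =>
    calc clip lo hi x ≤ clip lo hi (y + dist x y) :=
          clip_mono h (by rw [Real.dist_eq]; linarith [le_abs_self (x - y)])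
      _ ≤ clip lo hi y + dist x y := clip_add_le h dist_nonneg
  simpa using hlip.dist_le_mul x y

theorem clip_clip_add_of_nonneg (h : lo < hi) (hx : lo ≤ x) (hd : 0 ≤ d) (he : 0 ≤ e) :
    clip lo hi (clip lo hi (x + d) + e) = clip lo hi (x + d + e) := by
  have he' : (0 : EReal) ≤ e := by exact_mod_cast he
  have hxd : lo ≤ (x + d : ℝ) := hx.trans (by exact_mod_cast le_add_of_nonneg_right hd)
  have hxde : lo ≤ (x + d + e : ℝ) := hxd.trans (by exact_mod_cast le_add_of_nonneg_right he)
  have hclip : (clip lo hi (x + d) : EReal) = min ((x + d : ℝ) : EReal) hi := coe_clip_of_le h hxd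
  have hclip_e : lo ≤ (clip lo hi (x + d) + e : ℝ) := by
    rw [EReal.coe_add, hclip]
    exact (le_min hxd h.le).trans (le_add_of_nonneg_right he')
  rw [← EReal.coe_eq_coe_iff, coe_clip_of_le h hclip_e, coe_clip_of_le h hxde, EReal.coe_add,
    hclip, ← min_add_add_right, min_assoc, min_eq_right (le_add_of_nonneg_right he'),
    EReal.coe_add (x + d)]

theorem clip_clip_add_of_nonpos (h : lo < hi) (hx : (x : EReal) ≤ hi) (hd : d ≤ 0) (he : e ≤ 0) :
    clip lo hi (clip lo hi (x + d) + e) = clip lo hi (x + d + e) := by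
  have he' : (e : EReal) ≤ 0 := by exact_mod_cast he
  have hxd : ((x + d : ℝ) : EReal) ≤ hi := le_trans (by exact_mod_cast add_le_of_nonpos_right hd) hx
  have hxde : ((x + d + e : ℝ) : EReal) ≤ hi :=
    le_trans (by exact_mod_cast add_le_of_nonpos_right he) hxd
  have hclip : (clip lo hi (x + d) : EReal) = max lo ((x + d : ℝ) : EReal) := coe_clip_of_ge h hxd
  have hclip_e : ((clip lo hi (x + d) + e : ℝ) : EReal) ≤ hi := by
    rw [EReal.coe_add, hclip]
    exact (add_le_of_nonpos_right he').trans (max_le h.le hxd)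
  rw [← EReal.coe_eq_coe_iff, coe_clip_of_ge h hclip_e, coe_clip_of_ge h hxde, EReal.coe_add,
    hclip, ← max_add_add_right, ← max_assoc, max_eq_left (add_le_of_nonpos_right he'),
    EReal.coe_add (x + d)]

theorem clip_clip_add (h : lo < hi) (h₁ : lo ≤ x) (h₂ : (x : EReal) ≤ hi) (w : ℝ) (s t : ℝ≥0) :
    clip lo hi (clip lo hi (x + s * w) + t * w) = clip lo hi (x + (s + t) * w) := by
  rw [add_mul, ← add_assoc]
  rcases le_total 0 w with hw | hw
  · exact clip_clip_add_of_nonneg h h₁ (by positivity) (by positivity)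
  · exact clip_clip_add_of_nonpos h h₂ (mul_nonpos_of_nonneg_of_nonpos s.coe_nonneg hw)
      (mul_nonpos_of_nonneg_of_nonpos t.coe_nonneg hw)

end ClipLemmas

section BddMeas

variable {S : Type*} [MeasurableSpace S] {a b : S → EReal}

theorem abs_apply_le_norm (φ : BddMeas S) (x : S) : |φ.1 x| ≤ ‖φ‖ :=
  lp.norm_apply_le_norm ENNReal.top_ne_zero φ.1 x

theorem dist_le_of_forall_abs_sub_le {φ ψ : BddMeas S} {C : ℝ} (hC : 0 ≤ C)
    (h : ∀ x, |φ.1 x - ψ.1 x| ≤ C) : dist φ ψ ≤ C := by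
  rw [dist_eq_norm]
  exact lp.norm_le_of_forall_le (f := (φ - ψ).1) hC h

theorem dist_apply_le (φ ψ : BddMeas S) (x : S) : dist (φ.1 x) (ψ.1 x) ≤ dist φ ψ := by
  rw [Real.dist_eq, dist_eq_norm]
  exact abs_apply_le_norm (φ - ψ) x

theorem isClosed_bddMeas : IsClosed (BddMeas S : Set (lp (fun _ : S => ℝ) ∞)) := by
  refine IsSeqClosed.isClosed fun u φ hu huφ => ?_
  refine measurable_of_tendsto_metrizable (f := fun n x => u n x) hu (tendsto_pi_nhds.2 fun x => ?_)
  exact ((lp.uniformContinuous_coe.continuous.tendsto φ).comp huφ).apply_nhds x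

instance : CompleteSpace (BddMeas S) :=
  isClosed_bddMeas.completeSpace_coe

theorem isClosed_between : IsClosed (Between a b) := by
  simp only [Between, Set.ofPred_forall, Set.ofPred_and]
  refine isClosed_iInter fun x => ?_
  have hcont : Continuous fun φ : BddMeas S => ((φ.1 x : ℝ) : EReal) :=
    continuous_coe_real_ereal.comp (LipschitzWith.mk_one fun φ ψ => dist_apply_le φ ψ x).continuous
  exact (isClosed_le continuous_const hcont).inter (isClosed_le hcont continuous_const)

instance : CompleteSpace (Between a b) :=
  isClosed_between.completeSpace_coe

end BddMeas

section ClipArc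

variable {S : Type*} [MeasurableSpace S] {a b : S → EReal} {ha : Measurable a} {hb : Measurable b}
  {hab : 0 < ⨅ x, (b x - a x)} {V : Between a b → BddMeas S}

theorem lt_of_iInf_sub_pos {ι : Type*} {a b : ι → EReal} (h : 0 < ⨅ x, (b x - a x)) (x : ι) :
    a x < b x :=
  lt_of_sub_pos (h.trans_le (iInf_le _ x))

theorem clipArc_zero (f : Between a b) : clipArc a b ha hb hab V 0 f = f := by
  ext x
  change clip (a x) (b x) (f.1.1 x + ((0 : ℝ≥0) : ℝ) * (V f).1 x) = f.1.1 x
  rw [NNReal.coe_zero, zero_mul, add_zero]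
  exact clip_of_mem (lt_of_iInf_sub_pos hab x) (f.2 x).1 (f.2 x).2

theorem dist_clipArc_le (s t : ℝ≥0) (f g : Between a b) :
    dist (clipArc a b ha hb hab V s f) (clipArc a b ha hb hab V t g) ≤
      dist (f.1 + (s : ℝ) • V f) (g.1 + (t : ℝ) • V g) := by
  refine dist_le_of_forall_abs_sub_le dist_nonneg fun x => ?_
  exact (dist_clip_le (lt_of_iInf_sub_pos hab x) _ _).trans
    (dist_apply_le (f.1 + (s : ℝ) • V f) (g.1 + (t : ℝ) • V g) x)

theorem dist_clipArc_self_le (t : ℝ≥0) (f : Between a b) :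
    dist (clipArc a b ha hb hab V t f) f ≤ t * ‖V f‖ := by
  have h := dist_clipArc_le (ha := ha) (hb := hb) (hab := hab) (V := V) t 0 f f
  simpa [clipArc_zero, norm_smul] using h

theorem dist_clipArc_add_le (s t : ℝ≥0) (f : Between a b) :
    dist (clipArc a b ha hb hab V (s + t) f)
      (clipArc a b ha hb hab V t (clipArc a b ha hb hab V s f)) ≤
      t * dist (V f) (V (clipArc a b ha hb hab V s f)) := by
  set g := clipArc a b ha hb hab V s f
  refine dist_le_of_forall_abs_sub_le (by positivity) fun x => ?_
  have hadd : (clipArc a b ha hb hab V (s + t) f).1.1 x =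
      clip (a x) (b x) (g.1.1 x + t * (V f).1 x) :=
    (clip_clip_add (lt_of_iInf_sub_pos hab x) (f.2 x).1 (f.2 x).2 ((V f).1 x) s t).symm
  rw [hadd]
  refine (dist_clip_le (lt_of_iInf_sub_pos hab x) _ _).trans ?_
  rw [dist_add_left, Real.dist_eq, ← mul_sub, abs_mul, NNReal.abs_eq]
  gcongr
  exact dist_apply_le (V f) (V g) x

theorem isArcField_clipArc (hV : Continuous V) : IsArcField (clipArc a b ha hb hab V) := by
  refine ⟨Continuous.continuousOn ?_, clipArc_zero⟩
  have hline : Continuous fun q : Between a b × ℝ≥0 => q.1.1 + (q.2 : ℝ) • V q.1 :=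
    (continuous_subtype_val.comp continuous_fst).add
      ((NNReal.continuous_coe.comp continuous_snd).smul (hV.comp continuous_fst))
  refine continuous_iff_continuousAt.2 fun p => tendsto_iff_dist_tendsto_zero.2 ?_
  exact squeeze_zero (fun _ => dist_nonneg) (fun q => dist_clipArc_le q.2 p.2 q.1 p.1)
    (tendsto_iff_dist_tendsto_zero.1 (hline.tendsto p))

theorem exists_ball_lipschitzOnWith {E F : Type*} [PseudoMetricSpace E] [SeminormedAddCommGroup F]
    {V : E → F} (hV : LocallyLipschitz V) (p : E) :
    ∃ r > 0, ∃ K : ℝ≥0, ∃ C > 0, LipschitzOnWith K V (Metric.ball p r) ∧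
      ∀ f ∈ Metric.ball p r, ‖V f‖ ≤ C := by
  obtain ⟨K, U, hU, hVK⟩ := hV p
  obtain ⟨r, hr, hrU⟩ := Metric.mem_nhds_iff.1 hU
  have hLip := hVK.mono hrU
  refine ⟨r, hr, K, ‖V p‖ + K * r + 1, by positivity, hLip, fun f hf => ?_⟩
  have hdist := hLip.dist_le_mul f hf p (Metric.mem_ball_self hr)
  have hKr : K * dist f p ≤ K * r := by gcongr; exact (Metric.mem_ball.1 hf).le
  rw [dist_eq_norm] at hdist
  linarith [norm_le_norm_add_norm_sub' (V f) (V p)]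

theorem condE1_clipArc (hV : LocallyLipschitz V) : CondE1 (clipArc a b ha hb hab V) := by
  intro p
  obtain ⟨r, hr, K, C, -, hLip, -⟩ := exists_ball_lipschitzOnWith hV p
  refine ⟨r, hr, 1, one_pos, K, fun f hf g hg t _ _ => ?_⟩
  calc dist (clipArc a b ha hb hab V t f) (clipArc a b ha hb hab V t g)
      ≤ dist (f.1 + (t : ℝ) • V f) (g.1 + (t : ℝ) • V g) := dist_clipArc_le t t f g
    _ ≤ dist f g + t * dist (V f) (V g) := (dist_add_add_le _ _ _ _).trans_eq <| by
      rw [dist_eq_norm (_ • V f), ← smul_sub, norm_smul, Real.norm_eq_abs, NNReal.abs_eq,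
        dist_eq_norm (V f), Subtype.dist_eq f]
    _ ≤ dist f g + t * (K * dist f g) := by gcongr; exact hLip.dist_le_mul f hf g hg
    _ = (1 + t * K) * dist f g := by ring

theorem condE2_clipArc (hV : LocallyLipschitz V) : CondE2 (clipArc a b ha hb hab V) := by
  intro p
  obtain ⟨r, hr, K, C, hC, hLip, hVC⟩ := exists_ball_lipschitzOnWith hV p
  refine ⟨r / 2, by positivity, r / 2 / C, by positivity, K * C, fun f hf s t _ hs _ => ?_⟩
  have hfr : f ∈ Metric.ball p r := Metric.ball_subset_ball (half_le_self hr.le) hf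
  set g := clipArc a b ha hb hab V s f
  have hgf : dist g f ≤ s * C :=
    (dist_clipArc_self_le s f).trans (by gcongr; exact hVC f hfr)
  have hgr : g ∈ Metric.ball p r := by
    rw [lt_div_iff₀ hC] at hs
    rw [Metric.mem_ball] at hf ⊢
    linarith [dist_triangle g f p]
  calc dist (clipArc a b ha hb hab V (s + t) f) (clipArc a b ha hb hab V t g)
      ≤ t * dist (V f) (V g) := dist_clipArc_add_le s t f
    _ ≤ t * (K * (s * C)) := by
      gcongr
      exact (hLip.dist_le_mul f hfr g hgr).trans (by gcongr; rwa [dist_comm])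
    _ = s * t * (K * C) := by ring

end ClipArc

section LinearGrowth

variable {S : Type*} [MeasurableSpace S] {a b : S → EReal} {ha : Measurable a} {hb : Measurable b}
  {hab : 0 < ⨅ x, (b x - a x)} {V : Between a b → BddMeas S}

theorem lifetime_clipArc_eq_top (hV : LocallyLipschitz V) {A K : ℝ≥0}
    (hgrowth : ∀ f, ‖V f‖ ≤ A + K * ‖f.1‖) (p : Between a b) :
    lifetime (clipArc a b ha hb hab V) p = ∞ := by
  refine lifetime_eq_top_of_linear_growth (isArcField_clipArc hV.continuous) (condE1_clipArc hV)
    (condE2_clipArc hV) (A := A + K * ‖p.1‖₊) (K := K) (p := p) (fun f t _ => ?_) p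
  refine (dist_clipArc_self_le t f).trans ?_
  gcongr
  have hf : ‖f.1‖ ≤ ‖p.1‖ + dist f p := by
    rw [Subtype.dist_eq, dist_eq_norm]
    exact norm_le_norm_add_norm_sub' f.1 p.1
  calc ‖V f‖ ≤ A + K * ‖f.1‖ := hgrowth f
    _ ≤ A + K * (‖p.1‖ + dist f p) := by gcongr
    _ = (A + K * ‖p.1‖₊ : ℝ≥0) + K * dist f p := by push_cast; ring

theorem exists_norm_le_add_mul_norm {E F : Type*} [SeminormedAddCommGroup E]
    [SeminormedAddCommGroup F] {s : Set E} {V : s → F} {K : ℝ≥0} (hV : LipschitzWith K V) :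
    ∃ A : ℝ≥0, ∀ f : s, ‖V f‖ ≤ A + K * ‖f.1‖ := by
  rcases isEmpty_or_nonempty s with hs | ⟨⟨p⟩⟩
  · exact ⟨0, hs.elim⟩
  refine ⟨‖V p‖₊ + K * ‖p.1‖₊, fun f => ?_⟩
  have hdist : dist f p ≤ ‖p.1‖ + ‖f.1‖ := by
    rw [Subtype.dist_eq, dist_eq_norm, add_comm]
    exact norm_sub_le f.1 p.1
  calc ‖V f‖ ≤ ‖V p‖ + ‖V f - V p‖ := norm_le_norm_add_norm_sub' _ _
    _ ≤ ‖V p‖ + K * (‖p.1‖ + ‖f.1‖) := by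
      rw [← dist_eq_norm]
      gcongr
      exact (hV.dist_le_mul f p).trans (by gcongr)
    _ = (‖V p‖₊ + K * ‖p.1‖₊ : ℝ≥0) + K * ‖f.1‖ := by push_cast; ring

end LinearGrowth

end ArcField

theorem mainTheorem2_general {S : Type*} [MeasurableSpace S] (a b : S → EReal)
    (ha : Measurable a) (hb : Measurable b) (hab : 0 < ⨅ x, (b x - a x))
    (V : Between a b → BddMeas S) (hV : LocallyLipschitz V) :
    IsArcField (clipArc a b ha hb hab V) ∧
    CondE1 (clipArc a b ha hb hab V) ∧
    CondE2 (clipArc a b ha hb hab V) ∧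
    ∃ (T : Between a b → ℝ≥0∞) (F : ℝ≥0 → Between a b → Between a b),
      IsLocalFlowOf (clipArc a b ha hb hab V) T F ∧
      (∀ (T' : Between a b → ℝ≥0∞) (F' : ℝ≥0 → Between a b → Between a b),
        IsLocalFlowOf (clipArc a b ha hb hab V) T' F' →
          ∀ f, T' f ≤ T f ∧ ∀ t : ℝ≥0, (t : ℝ≥0∞) < T' f → F' t f = F t f) ∧
      (∀ (f : Between a b) (t : ℝ≥0), (t : ℝ≥0∞) < T f →
        Tendsto (fun n : ℕ => (clipArc a b ha hb hab V (t / (n : ℝ≥0)))^[n] f)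
          atTop (𝓝 (F t f))) ∧
      ((∃ A K : ℝ≥0, ∀ f, ‖V f‖ ≤ A + K * ‖f.1‖) →
        (∀ f, T f = ∞) ∧
        IsFlowOf (clipArc a b ha hb hab V) F ∧
        ∀ G : ℝ≥0 → Between a b → Between a b,
          IsFlowOf (clipArc a b ha hb hab V) G → G = F) := by
  have hX : IsArcField (clipArc a b ha hb hab V) := isArcField_clipArc hV.continuous
  have h1 : CondE1 (clipArc a b ha hb hab V) := condE1_clipArc hV
  have h2 : CondE2 (clipArc a b ha hb hab V) := condE2_clipArc hV
  have hflow := isLocalFlowOf_maxFlow hX h1 h2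
  refine ⟨hX, h1, h2, _, _, hflow, fun T' F' h f => ⟨h.le_lifetime f, fun t => h.eq_maxFlow h1⟩,
    fun f t => tendsto_eulerCurve_maxFlow hX h1 h2, ?_⟩
  rintro ⟨A, K, hgrowth⟩
  have htop := lifetime_clipArc_eq_top (ha := ha) (hb := hb) (hab := hab) hV hgrowth
  exact ⟨htop, hflow.isFlowOf htop, fun G hG => hG.eq_maxFlow h1⟩

theorem mainTheorem2 {S : Type*} [MeasurableSpace S] (a b : S → EReal)
    (ha : Measurable a) (hb : Measurable b) (hab : 0 < ⨅ x, (b x - a x))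
    (V : Between a b → BddMeas S) (hV : LocallyLipschitz V) :
    IsArcField (clipArc a b ha hb hab V) ∧
    CondE1 (clipArc a b ha hb hab V) ∧
    CondE2 (clipArc a b ha hb hab V) ∧
    ∃ (T : Between a b → ℝ≥0∞) (F : ℝ≥0 → Between a b → Between a b),
      IsLocalFlowOf (clipArc a b ha hb hab V) T F ∧
      (∀ (T' : Between a b → ℝ≥0∞) (F' : ℝ≥0 → Between a b → Between a b),
        IsLocalFlowOf (clipArc a b ha hb hab V) T' F' →
          ∀ f, T' f ≤ T f ∧ ∀ t : ℝ≥0, (t : ℝ≥0∞) < T' f → F' t f = F t f) ∧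
      (∀ (f : Between a b) (t : ℝ≥0), (t : ℝ≥0∞) < T f →
        Tendsto (fun n : ℕ => (clipArc a b ha hb hab V (t / (n : ℝ≥0)))^[n] f)
          atTop (𝓝 (F t f))) ∧
      ((∃ K : ℝ≥0, LipschitzWith K V) →
        (∀ f, T f = ∞) ∧
        IsFlowOf (clipArc a b ha hb hab V) F ∧
        ∀ G : ℝ≥0 → Between a b → Between a b,
          IsFlowOf (clipArc a b ha hb hab V) G → G = F) := by
  obtain ⟨hX, h1, h2, T, F, hflow, hmax, heuler, hglobal⟩ := mainTheorem2_general a b ha hb hab V hV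
  exact ⟨hX, h1, h2, T, F, hflow, hmax, heuler, fun ⟨K, hK⟩ =>
    hglobal ((exists_norm_le_add_mul_norm hK).imp fun _ h => ⟨K, h⟩)⟩
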